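/- Let $K$ be a non-archimedean local field with valuation ring $\mathcal O_K$, maximal ideal $\mathcal M_K$ and residue field with $q_K$ elements, and let $|\cdot|$ be the absolute value on $K$ normalized so that every uniformizer has absolute value $q_K^{-1}$. Let $|dx|$ be the product measure on $K^n$ of the Haar measure on $K$ that gives $\mathcal O_K$ measure $1$. Let $n\ge 0$ and $k\ge 1$ be integers, and suppose that the characteristic of $K$ is either $0$ or larger than $k$. Then there is a function $d_k:\mathbf R\to\mathbf R$, depending only on $K$, $n$ and $k$, such that the following holds. Let $\psi$ be an additive character (a homomorphism from $(K,+)$ to the unit circle) that is trivial on $\mathcal M_K$ and nontrivial on $\mathcal O_K$. Let $f=\sum_{i\in\mathbf N^n}a_ix^i\in K[[x_1,\dots,x_n]]$ be a power series that converges on $\mathcal O_K^n$, that is, $|a_i|\to 0$ as $i_1+\dots+i_n\to\infty$, and let $\|f-f(0)\|=\sup_{i\neq 0}|a_i|$ be the Gauss norm of $f-f(0)$ (read as $0$ if $n=0$). Suppose that for some multi-index $\alpha\in\mathbf N^n$ with $|\alpha|=\sum_j\alpha_j=k$ one has $$|\partial^\alpha f(x)|\ge 1\quad\text{for all }x\in\mathcal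 O_K^n,\qquad \partial^\alpha=\prod_j\frac{\partial^{\alpha_j}}{\partial x_j^{\alpha_j}}.$$ Then, for all nonzero $y\in K$, $$\left|\int_{\mathcal O_K^n}\psi(y\,f(x))\,|dx|\,\right|\le d_k\big(\|f-f(0)\|\big)\,|y|^{-1/k}.$$ -/

import Mathlib

noncomputable section

namespace OscInt

open MeasureTheory

section LocalField

variable (K : Type*) [NontriviallyNormedField K] [IsUltrametricDist K]

open scoped NormedField Valued in
/-- The norm of the non-archimedean field `K` is the normalized one: every uniformizer of the
valuation ring has norm `1 / q`, where `q` is the cardinality of the residue field. -/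
def IsNormalizedNorm : Prop :=
  ∀ ϖ : 𝒪[K], Irreducible ϖ → ‖(ϖ : K)‖ = ((Nat.card 𝓀[K] : ℕ) : ℝ)⁻¹

end LocalField

section Haar

variable (K : Type*) [NontriviallyNormedField K] [ProperSpace K]

/-- The valuation ring `{x : ‖x‖ ≤ 1}`, as a compact set with nonempty interior. -/
def unitBall : TopologicalSpace.PositiveCompacts K where
  carrier := Metric.closedBall 0 1
  isCompact' := isCompact_closedBall 0 1
  interior_nonempty' :=
    ⟨0, Metric.ball_subset_interior_closedBall (Metric.mem_ball_self one_pos)⟩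

/-- The additive Haar measure on `K`, normalized so that the valuation ring has measure `1`. -/
def haar [MeasurableSpace K] [BorelSpace K] : Measure K :=
  Measure.addHaarMeasure (unitBall K)

/-- The product measure `|dx|` on `Kⁿ`. -/
def haarPi [MeasurableSpace K] [BorelSpace K] (n : ℕ) : Measure (Fin n → K) :=
  Measure.pi fun _ => haar K

end Haar

/-- The polydisc `𝒪ⁿ` in `Kⁿ`: all coordinates have norm at most `1`. -/
def integerBox (K : Type*) [NormedField K] (n : ℕ) : Set (Fin n → K) :=
  {x | ∀ j, ‖x j‖ ≤ 1}

/-- The additive character `ψ` is trivial on the maximal ideal `{x : ‖x‖ < 1}` and nontrivial on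
the valuation ring `{x : ‖x‖ ≤ 1}`. -/
def HasConductorMaximalIdeal {K : Type*} [NormedField K] (ψ : AddChar K Circle) : Prop :=
  (∀ x : K, ‖x‖ < 1 → ψ x = 1) ∧ ∃ x : K, ‖x‖ ≤ 1 ∧ ψ x ≠ 1

section PowerSeries

variable {K : Type*} [NormedField K] {n : ℕ}

/-- The power series `f` converges on `𝒪ⁿ`: its coefficients tend to `0`. -/
def ConvergesOnIntegers (f : MvPowerSeries (Fin n) K) : Prop :=
  MvPowerSeries.IsRestricted (fun _ => 1) f

/-- The value `f(x) = ∑ aᵢ xⁱ`; the sum converges if `f` converges on `𝒪ⁿ`, `x` lies in `𝒪ⁿ` and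
`K` is complete and non-archimedean. -/
def evalAt (f : MvPowerSeries (Fin n) K) (x : Fin n → K) : K :=
  ∑' i : Fin n →₀ ℕ, MvPowerSeries.coeff i f * ∏ j, x j ^ i j

/-- The Gauss norm `sup |aᵢ|` of `f`. -/
def gaussNorm (f : MvPowerSeries (Fin n) K) : ℝ :=
  MvPowerSeries.gaussNorm (fun a : K => ‖a‖) (fun _ => 1) f

/-- The iterated partial derivative `∂^α f = (∏ⱼ ∂ⱼ^{αⱼ}) f`. -/
def iteratedPDeriv (α : Fin n → ℕ) (f : MvPowerSeries (Fin n) K) : MvPowerSeries (Fin n) K :=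
  (List.ofFn fun j => ((MvPowerSeries.pderiv K j).toLinearMap ^ α j :
    Module.End K (MvPowerSeries (Fin n) K))).prod f

end PowerSeries

end OscInt

end

/-! The proof is a non-archimedean van der Corput argument.

One variable (`exists_norm_integral_addChar_le`): let `Q` be a polynomial whose `k`-th coefficient
dominates all later ones. For `k = 1`, averaging over translates of size `1 / ‖Q₁‖` leaves integrals
of a nontrivial character, which vanish. From `k` to `k + 1`: since `k + 1 ≠ 0` in `K`, the `k`-th
Taylor coefficient of `Q` at `t` is a similarity in `t`, hence at least `‖k + 1‖ ‖Q_{k+1}‖ ‖t - t₀‖`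
in norm for a suitable `t₀`. On each ring around `t₀` the case `k` applies at a small scale; the
ball of radius about `‖Q_{k+1}‖ ^ (-1/(k+1))` is estimated trivially.

Several variables (`exists_norm_integral_polynomial_le`): near each `x` the degree `k` form of the
translate has a coefficient of norm at least `1`, so it is bounded below at some direction `v` by a
constant depending only on `K`, `n`, `k` (`exists_norm_coeff_le_norm_eval`). On lines `x + a (z + t
v)` with `‖a‖` small compared with the inverse of the Gauss norm, the coefficient of `t ^ k`
dominates the later ones, and the one-variable bound applies.

Power series: `ψ` is trivial on the maximal ideal, so `f` may be replaced by a polynomial close to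
it on the scale `1 / ‖y‖`. -/

noncomputable section

namespace OscInt

open MeasureTheory

/-! ### Haar measure of balls. -/

section HaarScaling

variable (K : Type*) [NontriviallyNormedField K] [ProperSpace K]
  [MeasurableSpace K] [BorelSpace K]

instance : (haar K).IsAddHaarMeasure := by unfold haar; infer_instance

instance : (haar K).Regular := by unfold haar; infer_instance

theorem haar_closedBall_one : haar K (Metric.closedBall 0 1) = 1 :=
  Measure.addHaarMeasure_self (K₀ := unitBall K)

open scoped Pointwise in
theorem haar_closedBall_norm_pow (a : K) (ha : a ≠ 0) (m : ℕ) :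
    haar K (Metric.closedBall 0 (‖a‖ ^ m)) = haar K (Metric.closedBall 0 ‖a‖) ^ m := by
  have key : ∀ r : ℝ, haar K (Metric.closedBall 0 (‖a‖ * r)) =
      distribHaarChar K (Units.mk0 a ha) * haar K (Metric.closedBall 0 r) := by
    intro r
    rw [distribHaarChar_mul]
    congr 1
    change _ = a • Metric.closedBall (0 : K) r
    rw [smul_closedBall' ha, smul_zero]
  have h1 := key 1
  rw [mul_one, haar_closedBall_one, mul_one] at h1
  rw [h1]
  induction m with
  | zero => simp [haar_closedBall_one]
  | succ m ih => rw [pow_succ', key, ih, pow_succ']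

variable [IsUltrametricDist K]

open scoped NormedField Valued in
-- The valuation ring is the disjoint union of `q` translates of its maximal ideal, so the latter
-- has measure `1 / q`, which by normalization is the norm of a uniformizer.
theorem exists_haar_closedBall_eq (hK : IsNormalizedNorm K) :
    ∃ a : K, 0 < ‖a‖ ∧ ‖a‖ < 1 ∧ ∀ m : ℕ,
      haar K (Metric.closedBall 0 (‖a‖ ^ m)) = ENNReal.ofReal (‖a‖ ^ m) := by
  have hcpt : CompactSpace 𝒪[K] := by
    rw [← isCompact_univ_iff, Subtype.isCompact_iff]
    convert isCompact_closedBall (0 : K) 1 using 1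
    ext x
    simp [Valued.integer.mem_iff]
  let : (Valued.v : Valuation K NNReal).RankOne :=
    inferInstanceAs (NormedField.valuation (K := K)).RankOne
  have : IsDiscreteValuationRing 𝒪[K] := Valued.integer.isDiscreteValuationRing_of_compactSpace
  have : Finite 𝓀[K] :=
    (Valued.integer.compactSpace_iff_completeSpace_and_isDiscreteValuationRing_and_finite_residueField.mp
      hcpt).2.2
  obtain ⟨ϖ, hϖ⟩ := IsDiscreteValuationRing.exists_irreducible 𝒪[K]
  have hpos : 0 < ‖(ϖ : K)‖ := Valued.integer.norm_irreducible_pos hϖ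
  have hlt : ‖(ϖ : K)‖ < 1 := Valued.integer.norm_irreducible_lt_one hϖ
  refine ⟨ϖ, hpos, hlt, ?_⟩
  suffices h : haar K (Metric.closedBall 0 ‖(ϖ : K)‖) = ENNReal.ofReal ‖(ϖ : K)‖ by
    intro m
    rw [haar_closedBall_norm_pow K _ (norm_pos_iff.mp hpos), h, ENNReal.ofReal_pow hpos.le]
  have hmem : ∀ x : 𝒪[K], IsLocalRing.residue 𝒪[K] x = 0 ↔ ‖(x : K)‖ ≤ ‖(ϖ : K)‖ := by
    intro x
    rw [IsLocalRing.residue_eq_zero_iff, ← SetLike.mem_coe,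
      hϖ.maximalIdeal_eq_closedBall]
    simp
  have := Fintype.ofFinite 𝓀[K]
  choose s hs using (IsLocalRing.residue_surjective (R := 𝒪[K]))
  have hU : Metric.closedBall (0 : K) 1 = ⋃ r : 𝓀[K], Metric.closedBall (s r : K) ‖(ϖ : K)‖ := by
    ext x
    simp only [Set.mem_iUnion, mem_closedBall_iff_norm, sub_zero]
    constructor
    · intro hx
      refine ⟨IsLocalRing.residue 𝒪[K] ⟨x, Valued.integer.mem_iff.mpr hx⟩, ?_⟩
      have := (hmem (⟨x, Valued.integer.mem_iff.mpr hx⟩ -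
        s (IsLocalRing.residue 𝒪[K] ⟨x, Valued.integer.mem_iff.mpr hx⟩))).mp (by
          rw [map_sub, hs, sub_self])
      simpa [hs] using this
    · rintro ⟨r, hr⟩
      have h1 : ‖(s r : K)‖ ≤ 1 := Valued.integer.mem_iff.mp (s r).2
      have := IsUltrametricDist.norm_add_le_max (x - s r) (s r : K)
      rw [sub_add_cancel] at this
      exact this.trans (max_le (hr.trans hlt.le) h1)
  have hdisj : Pairwise (Function.onFun Disjoint
      fun r : 𝓀[K] => Metric.closedBall (s r : K) ‖(ϖ : K)‖) := by
    intro r r' hrr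
    rw [Function.onFun, Set.disjoint_left]
    intro x hx hx'
    apply hrr
    rw [mem_closedBall_iff_norm] at hx hx'
    rw [← hs r, ← hs r', ← sub_eq_zero, ← map_sub, hmem]
    have := IsUltrametricDist.norm_add_le_max ((s r : K) - x) (x - s r')
    rw [sub_add_sub_cancel, norm_sub_rev _ x] at this
    exact this.trans (max_le hx hx')
  have hsum := measure_iUnion (μ := haar K) hdisj fun r => Metric.isClosed_closedBall.measurableSet
  rw [← hU, haar_closedBall_one, tsum_fintype] at hsum
  have hball : ∀ r : 𝓀[K], haar K (Metric.closedBall (s r : K) ‖(ϖ : K)‖) =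
      haar K (Metric.closedBall 0 ‖(ϖ : K)‖) := fun r => Measure.addHaar_closedBall_center _ _ _
  simp only [hball, Finset.sum_const, Finset.card_univ, nsmul_eq_mul] at hsum
  rw [hK ϖ hϖ, Nat.card_eq_fintype_card] at *
  rw [ENNReal.ofReal_inv_of_pos (by positivity), ENNReal.ofReal_natCast]
  exact ENNReal.eq_inv_of_mul_eq_one_left (by rw [mul_comm]; exact hsum.symm)

end HaarScaling

/-! ### The unit polydisc and averaging over translations. -/

section Box

theorem continuous_of_hasConductorMaximalIdeal {K : Type*} [NormedField K] {ψ : AddChar K Circle}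
    (hψ : HasConductorMaximalIdeal ψ) : Continuous ψ := by
  refine continuous_iff_continuousAt.mpr fun x => ?_
  refine tendsto_nhds_of_eventually_eq ?_
  filter_upwards [Metric.ball_mem_nhds x one_pos] with z hz
  rw [mem_ball_iff_norm] at hz
  rw [← sub_add_cancel z x, AddChar.map_add_eq_mul, hψ.1 _ hz, one_mul]

theorem integerBox_eq_pi (K : Type*) [NormedField K] (n : ℕ) : integerBox K n = Set.univ.pi fun _ => Metric.closedBall 0 1 := by
  ext x; simp [integerBox]

theorem measurableSet_integerBox (K : Type*) [NormedField K] [MeasurableSpace K] [BorelSpace K]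
    (n : ℕ) : MeasurableSet (integerBox K n) := by
  rw [integerBox_eq_pi]
  exact MeasurableSet.univ_pi fun _ => Metric.isClosed_closedBall.measurableSet

variable (K : Type*) [NontriviallyNormedField K] [ProperSpace K]
  [MeasurableSpace K] [BorelSpace K] (n : ℕ)

instance : (haarPi K n).IsAddHaarMeasure := by unfold haarPi; infer_instance

theorem haarPi_integerBox : haarPi K n (integerBox K n) = 1 := by
  rw [integerBox_eq_pi, haarPi, Measure.pi_pi]
  simp [haar_closedBall_one]

end Box

/-- If a set `A` is invariant under the translations by `φ t`, `t ∈ T`, with `T` of measure `1`,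
then the integral of `F` over `A` is the integral over `A` of the averages of `F` over these
translations. -/
theorem norm_setIntegral_le_of_translate {X Y : Type*} [AddCommGroup X] [MeasurableSpace X]
    [MeasurableAdd₂ X] [MeasurableSpace Y] (μ : Measure X) [SFinite μ] [μ.IsAddLeftInvariant]
    (ν : Measure Y) [SFinite ν] {A : Set X} (hA : MeasurableSet A) (hμA : μ A ≠ ⊤)
    {T : Set Y} (hT : MeasurableSet T) (hνT : ν T = 1) {φ : Y → X} (hφ : Measurable φ)
    (hAφ : ∀ t ∈ T, ∀ x, x + φ t ∈ A ↔ x ∈ A) {F : X → ℂ} (hF : Measurable F)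
    (hF1 : ∀ x, ‖F x‖ ≤ 1) {B : ℝ} (hB : ∀ x ∈ A, ‖∫ t in T, F (x + φ t) ∂ν‖ ≤ B) :
    ‖∫ x in A, F x ∂μ‖ ≤ B * μ.real A := by
  have : IsFiniteMeasure (μ.restrict A) := ⟨by simpa using hμA.lt_top⟩
  have : IsProbabilityMeasure (ν.restrict T) := ⟨by simpa using hνT⟩
  have h1 : ∀ t ∈ T, ∫ x in A, F (x + φ t) ∂μ = ∫ x in A, F x ∂μ := by
    intro t ht
    rw [← integral_indicator hA, ← integral_indicator hA,
      ← integral_add_right_eq_self (A.indicator F) (φ t)]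
    congr 1
    funext x
    by_cases hx : x ∈ A
    · rw [Set.indicator_of_mem hx, Set.indicator_of_mem ((hAφ t ht x).mpr hx)]
    · rw [Set.indicator_of_notMem hx, Set.indicator_of_notMem (mt (hAφ t ht x).mp hx)]
  have h2 : ∫ x in A, F x ∂μ = ∫ t in T, ∫ x in A, F (x + φ t) ∂μ ∂ν := by
    rw [setIntegral_congr_fun hT h1, setIntegral_const, measureReal_def, hνT]
    rw [ENNReal.toReal_one, one_smul]
  rw [h2, integral_integral_swap]
  · exact norm_setIntegral_le_of_norm_le_const hμA.lt_top hB
  · refine Integrable.of_bound (C := 1) ?_ (Filter.Eventually.of_forall fun p => hF1 _)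
    exact (hF.comp (measurable_snd.add (hφ.comp measurable_fst))).aestronglyMeasurable

end OscInt
end

noncomputable section

namespace OscInt

open MeasureTheory Polynomial

/-! ### Taylor coefficients over an ultrametric field. -/

section TaylorBounds

variable {K : Type*} [NormedField K] [IsUltrametricDist K]

theorem norm_eq_of_norm_sub_lt {x y : K} (h : ‖x - y‖ < ‖y‖) :
    ‖x‖ = ‖y‖ := by
  have := IsUltrametricDist.norm_add_eq_max_of_norm_ne_norm h.ne
  rwa [sub_add_cancel, max_eq_right h.le] at this

theorem norm_natCast_mul_le (m : ℕ) (x : K) : ‖(m : K) * x‖ ≤ ‖x‖ := by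
  rw [norm_mul]
  exact mul_le_of_le_one_left (norm_nonneg _) (IsUltrametricDist.norm_natCast_le_one K m)

omit [IsUltrametricDist K] in
theorem coeff_taylor_eq_sum (G : K[X]) (u : K) (k : ℕ) {N : ℕ} (hN : G.natDegree < N) :
    (taylor u G).coeff k =
      ∑ i ∈ Finset.range N, (((k + i).choose k : ℕ) : K) * (G.coeff (k + i) * u ^ i) := by
  rw [taylor_coeff, eval_eq_sum_range' (n := N)
    ((natDegree_hasseDeriv_le G k).trans_lt (lt_of_le_of_lt (Nat.sub_le _ _) hN))]
  refine Finset.sum_congr rfl fun i _ => ?_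
  rw [hasseDeriv_coeff, add_comm i k, mul_assoc]

theorem norm_coeff_taylor_le {G : K[X]} {u : K} (hu : ‖u‖ ≤ 1) {B : ℝ} {k : ℕ}
    (hG : ∀ i, k ≤ i → ‖G.coeff i‖ ≤ B) : ‖(taylor u G).coeff k‖ ≤ B := by
  have hB : 0 ≤ B := (norm_nonneg _).trans (hG k le_rfl)
  rw [coeff_taylor_eq_sum G u k (Nat.lt_succ_self _)]
  refine IsUltrametricDist.norm_sum_le_of_forall_le_of_nonneg hB fun i _ => ?_
  refine (norm_natCast_mul_le _ _).trans ?_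
  rw [norm_mul, norm_pow]
  exact (mul_le_of_le_one_right (norm_nonneg _) (pow_le_one₀ (norm_nonneg _) hu)).trans
    (hG _ (Nat.le_add_right _ _))

theorem norm_coeff_taylor_sub_le {G : K[X]} {u : K} (hu : ‖u‖ ≤ 1) {B : ℝ} {k : ℕ}
    (hG : ∀ i, k < i → ‖G.coeff i‖ ≤ B) : ‖(taylor u G).coeff k - G.coeff k‖ ≤ B := by
  have hB : 0 ≤ B := (norm_nonneg _).trans (hG (k + 1) (Nat.lt_succ_self k))
  rw [coeff_taylor_eq_sum G u k (N := G.natDegree + 1 + 1) (by omega), Finset.sum_range_succ']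
  simp only [add_zero, Nat.choose_self, Nat.cast_one, one_mul, pow_zero, mul_one,
    add_sub_cancel_right]
  refine IsUltrametricDist.norm_sum_le_of_forall_le_of_nonneg hB fun i _ => ?_
  refine (norm_natCast_mul_le _ _).trans ?_
  rw [norm_mul, norm_pow]
  exact (mul_le_of_le_one_right (norm_nonneg _) (pow_le_one₀ (norm_nonneg _) hu)).trans
    (hG _ (by omega))

theorem norm_coeff_taylor_sub_sub_le {G : K[X]} {u : K} (hu : ‖u‖ ≤ 1) {B : ℝ} {k : ℕ}
    (hG : ∀ i, k + 1 < i → ‖G.coeff i‖ ≤ B) :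
    ‖(taylor u G).coeff k - G.coeff k - ((k + 1 : ℕ) : K) * (G.coeff (k + 1) * u)‖ ≤
      B * ‖u‖ := by
  have hB : 0 ≤ B := (norm_nonneg _).trans (hG (k + 2) (by omega))
  rw [coeff_taylor_eq_sum G u k (N := G.natDegree + 1 + 1 + 1) (by omega),
    Finset.sum_range_succ', Finset.sum_range_succ']
  simp only [add_zero, Nat.choose_self, Nat.cast_one, one_mul, pow_zero, mul_one,
    add_sub_cancel_right, zero_add, pow_one, Nat.choose_succ_self_right]
  refine IsUltrametricDist.norm_sum_le_of_forall_le_of_nonneg (by positivity) fun i _ => ?_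
  refine (norm_natCast_mul_le _ _).trans ?_
  rw [norm_mul, norm_pow, pow_succ]
  refine mul_le_mul (hG _ (by omega)) ?_ (by positivity) hB
  exact mul_le_of_le_one_left (norm_nonneg _) (pow_le_one₀ (norm_nonneg _) hu)

theorem norm_coeff_taylor_eq {G : K[X]} {u : K} (hu : ‖u‖ ≤ 1) {B : ℝ} {k : ℕ}
    (hG : ∀ i, k < i → ‖G.coeff i‖ ≤ B) (hB : B < ‖G.coeff k‖) :
    ‖(taylor u G).coeff k‖ = ‖G.coeff k‖ :=
  norm_eq_of_norm_sub_lt (lt_of_le_of_lt (norm_coeff_taylor_sub_le hu hG) hB)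

/-- If `G_{k+1}` dominates the higher coefficients, then the `k`-th Taylor coefficient of `G` is
a similarity on the valuation ring. -/
theorem norm_coeff_taylor_sub_coeff_taylor {Q : K[X]} {k : ℕ} {θ : ℝ} (hθ1 : θ < 1)
    (hθ : θ < ‖((k + 1 : ℕ) : K)‖) (hQ0 : Q.coeff (k + 1) ≠ 0)
    (hQ : ∀ i, k + 1 < i → ‖Q.coeff i‖ ≤ θ * ‖Q.coeff (k + 1)‖) {t t' : K} (ht : ‖t‖ ≤ 1)
    (ht' : ‖t'‖ ≤ 1) :
    ‖(taylor t Q).coeff k - (taylor t' Q).coeff k‖ =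
      ‖((k + 1 : ℕ) : K)‖ * ‖Q.coeff (k + 1)‖ * ‖t - t'‖ := by
  have hL : 0 < ‖Q.coeff (k + 1)‖ := norm_pos_iff.mpr hQ0
  have hu : ‖t - t'‖ ≤ 1 := by
    have := IsUltrametricDist.norm_add_le_max t (-t')
    rw [← sub_eq_add_neg, norm_neg] at this
    exact this.trans (max_le ht ht')
  have hG1 : ‖(taylor t' Q).coeff (k + 1)‖ = ‖Q.coeff (k + 1)‖ :=
    norm_coeff_taylor_eq ht' hQ (by nlinarith)
  have hG : ∀ i, k + 1 < i → ‖(taylor t' Q).coeff i‖ ≤ θ * ‖Q.coeff (k + 1)‖ := fun i hi =>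
    norm_coeff_taylor_le ht' fun j hj => hQ j (hi.trans_le hj)
  -- Recentred at `t'`, the difference is its linear term up to an error of at most `θ * ‖Q.coeff (k
  -- + 1)‖ * ‖t - t'‖`; since `θ < ‖k + 1‖`, the linear term wins.
  have key := norm_coeff_taylor_sub_sub_le hu hG
  rw [taylor_taylor, sub_add_cancel] at key
  rcases eq_or_ne t t' with rfl | hne
  · simp
  have hpos : 0 < ‖t - t'‖ := norm_pos_iff.mpr (sub_ne_zero.mpr hne)
  have hval : ‖((k + 1 : ℕ) : K) * ((taylor t' Q).coeff (k + 1) * (t - t'))‖ =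
      ‖((k + 1 : ℕ) : K)‖ * ‖Q.coeff (k + 1)‖ * ‖t - t'‖ := by
    rw [norm_mul, norm_mul, hG1, mul_assoc]
  rw [← hval]
  refine norm_eq_of_norm_sub_lt (lt_of_le_of_lt key ?_)
  rw [hval]
  gcongr

end TaylorBounds

/-- Summation over rings: `I m` stands for the integral over the ball of radius `p ^ m`, the added
term for the ring it loses. The ring terms grow geometrically with ratio `p ^ (-1/k)`, so their sum
is comparable to the last one. Stopping at `p ^ m ≈ L ^ (-1/(k+1))` balances it against the trivial
bound. -/
theorem le_mul_rpow_of_le_add_succ {p : ℝ} (hp0 : 0 < p) (hp1 : p < 1) {k : ℕ} (hk : 0 < k)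
    {A C : ℝ} (hA : 0 < A) (hC : 0 ≤ C) :
    ∃ D : ℝ, 0 ≤ D ∧ ∀ L : ℝ, 0 < L → ∀ I : ℕ → ℝ, (∀ m, I m ≤ p ^ m) →
      (∀ m, I m ≤ I (m + 1) + C * (A * L * (p ^ m) ^ (k + 1)) ^ (-(1 / (k : ℝ))) * p ^ m) →
      I 0 ≤ D * L ^ (-(1 / ((k + 1 : ℕ) : ℝ))) := by
  have hk' : (0 : ℝ) < k := by exact_mod_cast hk
  set X : ℝ := p ^ (-(1 / (k : ℝ))) with hX
  have hX1 : 1 < X := Real.one_lt_rpow_of_pos_of_lt_one_of_neg hp0 hp1 (by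
    have : 0 < 1 / (k : ℝ) := by positivity
    linarith)
  set D : ℝ := C * A ^ (-(1 / (k : ℝ))) * (X / (X - 1)) with hD
  have hX0 : 0 < X - 1 := by linarith
  have hD0 : 0 ≤ D := by positivity
  refine ⟨1 + D, by linarith, fun L hL I h1 h2 => ?_⟩
  rcases le_total L 1 with hL1 | hL1
  · have hLr : 1 ≤ L ^ (-(1 / ((k + 1 : ℕ) : ℝ))) :=
      Real.one_le_rpow_of_pos_of_le_one_of_nonpos hL hL1 (by
        have : 0 < 1 / ((k + 1 : ℕ) : ℝ) := by positivity
        linarith)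
    have := h1 0
    rw [pow_zero] at this
    nlinarith
  set Λ : ℝ := L ^ (-(1 / ((k + 1 : ℕ) : ℝ))) with hΛ
  have hΛ0 : 0 < Λ := Real.rpow_pos_of_pos hL _
  have hΛ1 : Λ ≤ 1 := Real.rpow_le_one_of_one_le_of_nonpos hL1 (by
        have : 0 < 1 / ((k + 1 : ℕ) : ℝ) := by positivity
        linarith)
  have hterm : ∀ m, C * (A * L * (p ^ m) ^ (k + 1)) ^ (-(1 / (k : ℝ))) * p ^ m =
      C * A ^ (-(1 / (k : ℝ))) * L ^ (-(1 / (k : ℝ))) * X ^ m := by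
    intro m
    have hpm : 0 < p ^ m := by positivity
    have e1 : ((p ^ m) ^ k) ^ (-(1 / (k : ℝ))) = (p ^ m)⁻¹ := by
      rw [← Real.rpow_natCast (p ^ m) k, ← Real.rpow_mul hpm.le, ← Real.rpow_neg_one]
      congr 1
      field_simp
    have e2 : (p ^ m) ^ (-(1 / (k : ℝ))) = X ^ m := by
      rw [hX, ← Real.rpow_natCast, ← Real.rpow_natCast, ← Real.rpow_mul hp0.le,
        ← Real.rpow_mul hp0.le, mul_comm]
    rw [pow_succ, Real.mul_rpow (by positivity) (by positivity),
      Real.mul_rpow hA.le hL.le, Real.mul_rpow (by positivity) hpm.le, e1, e2]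
    field_simp
  have hsum : ∀ N, I 0 ≤ I N +
      C * A ^ (-(1 / (k : ℝ))) * L ^ (-(1 / (k : ℝ))) * ∑ m ∈ Finset.range N, X ^ m := by
    intro N
    induction N with
    | zero => simp
    | succ N ih =>
      have := h2 N
      rw [hterm] at this
      rw [Finset.sum_range_succ, mul_add]
      linarith
  obtain ⟨N, hN1, hN2⟩ := exists_nat_pow_near_of_lt_one hΛ0 hΛ1 hp0 hp1
  have hXN : ∑ m ∈ Finset.range (N + 1), X ^ m ≤ X / (X - 1) * (Λ ^ (-(1 / (k : ℝ)))) := by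
    rw [geom_sum_eq hX1.ne', div_mul_eq_mul_div]
    refine div_le_div_of_nonneg_right ?_ hX0.le
    have : X ^ N ≤ Λ ^ (-(1 / (k : ℝ))) := by
      rw [hX, ← Real.rpow_natCast, ← Real.rpow_mul hp0.le, mul_comm, Real.rpow_mul hp0.le,
        Real.rpow_natCast]
      exact Real.rpow_le_rpow_of_nonpos hΛ0 hN2 (by
        have : 0 < 1 / (k : ℝ) := by positivity
        linarith)
    rw [pow_succ']
    have := mul_le_mul_of_nonneg_left this (by linarith : 0 ≤ X)
    linarith
  have hexp : L ^ (-(1 / (k : ℝ))) * Λ ^ (-(1 / (k : ℝ))) = Λ := by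
    rw [hΛ, ← Real.rpow_mul hL.le, ← Real.rpow_add hL]
    congr 1
    push_cast
    field_simp
    ring
  calc I 0 ≤ _ := hsum (N + 1)
    _ ≤ Λ + C * A ^ (-(1 / (k : ℝ))) * L ^ (-(1 / (k : ℝ))) *
        (X / (X - 1) * (Λ ^ (-(1 / (k : ℝ))))) := by
      gcongr
      exact (h1 _).trans hN1.le
    _ = Λ + D * (L ^ (-(1 / (k : ℝ))) * Λ ^ (-(1 / (k : ℝ)))) := by rw [hD]; ring
    _ = (1 + D) * Λ := by rw [hexp]; ring

end OscInt
end

noncomputable section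

namespace OscInt

open MeasureTheory Polynomial

/-! ### The one-variable estimate, by induction on `k`. -/

section OneVariable

variable {K : Type*} [NontriviallyNormedField K] [IsUltrametricDist K] [ProperSpace K]
  [MeasurableSpace K] [BorelSpace K]

omit [IsUltrametricDist K] [ProperSpace K] [MeasurableSpace K] [BorelSpace K] in
theorem measurable_comp_addChar {X : Type*} [TopologicalSpace X] [MeasurableSpace X]
    [OpensMeasurableSpace X] {ψ : AddChar K Circle} (hψ : HasConductorMaximalIdeal ψ)
    {g : X → K} (hg : Continuous g) : Measurable fun x => (ψ (g x) : ℂ) :=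
  (continuous_subtype_val.comp
    ((continuous_of_hasConductorMaximalIdeal hψ).comp hg)).measurable

/-- Orthogonality: translating `u` by `w / a`, where `ψ w ≠ 1`, multiplies the integral by `ψ w`. -/
theorem integral_addChar_mul_eq_zero {ψ : AddChar K Circle} (hψ : HasConductorMaximalIdeal ψ)
    {a : K} (ha : ‖a‖ = 1) (b : K) :
    ∫ u in Metric.closedBall (0 : K) 1, (ψ (b + a * u) : ℂ) ∂(haar K) = 0 := by
  obtain ⟨w, hw1, hw⟩ := hψ.2
  have ha0 : a ≠ 0 := by rintro rfl; simp at ha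
  set F : K → ℂ := (Metric.closedBall (0 : K) 1).indicator fun u => (ψ (b + a * u) : ℂ) with hF
  have hball : MeasurableSet (Metric.closedBall (0 : K) 1) :=
    Metric.isClosed_closedBall.measurableSet
  have hmem : ∀ u : K, u + w / a ∈ Metric.closedBall (0 : K) 1 ↔
      u ∈ Metric.closedBall (0 : K) 1 := by
    have hwa : ‖w / a‖ ≤ 1 := by rwa [norm_div, ha, div_one]
    intro u
    simp only [mem_closedBall_zero_iff]
    constructor
    · intro h
      have := IsUltrametricDist.norm_add_le_max (u + w / a) (-(w / a))
      rw [add_neg_cancel_right, norm_neg] at this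
      exact this.trans (max_le h hwa)
    · intro h
      exact (IsUltrametricDist.norm_add_le_max _ _).trans (max_le h hwa)
  have hshift : ∀ u, F (u + w / a) = (ψ w : ℂ) * F u := by
    intro u
    rw [hF]
    by_cases hu : u ∈ Metric.closedBall (0 : K) 1
    · rw [Set.indicator_of_mem hu, Set.indicator_of_mem ((hmem u).mpr hu)]
      rw [mul_add, mul_div_cancel₀ _ ha0, ← add_assoc, AddChar.map_add_eq_mul, Circle.coe_mul,
        mul_comm]
    · rw [Set.indicator_of_notMem hu, Set.indicator_of_notMem (mt (hmem u).mp hu), mul_zero]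
  have h1 : ∫ u, F u ∂(haar K) = (ψ w : ℂ) * ∫ u, F u ∂(haar K) := by
    rw [← integral_const_mul, ← integral_add_right_eq_self F (w / a)]
    exact integral_congr_ae (Filter.Eventually.of_forall hshift)
  rw [← integral_indicator hball]
  have h2 : (1 - (ψ w : ℂ)) * ∫ u, F u ∂(haar K) = 0 := by
    rw [sub_mul, one_mul, ← h1, sub_self]
  rcases mul_eq_zero.mp h2 with h | h
  · exact absurd (Circle.ext (by rw [Circle.coe_one]; exact (sub_eq_zero.mp h).symm)) hw
  · exact h

theorem integral_addChar_eval_eq_zero {ψ : AddChar K Circle} (hψ : HasConductorMaximalIdeal ψ)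
    {S : K[X]} (h1 : ‖S.coeff 1‖ = 1) {B : ℝ} (hB : B < 1) (hS : ∀ i, 1 < i → ‖S.coeff i‖ ≤ B) :
    ∫ u in Metric.closedBall (0 : K) 1, (ψ (S.eval u) : ℂ) ∂(haar K) = 0 := by
  rw [← integral_addChar_mul_eq_zero hψ h1 (S.coeff 0)]
  refine setIntegral_congr_fun Metric.isClosed_closedBall.measurableSet fun u hu => ?_
  rw [mem_closedBall_zero_iff] at hu
  have key := norm_coeff_taylor_sub_sub_le (k := 0) hu hS
  simp only [taylor_coeff_zero, zero_add, Nat.cast_one, one_mul] at key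
  have hB0 : 0 ≤ B := (norm_nonneg _).trans (hS 2 (by norm_num))
  have hlt : ‖S.eval u - S.coeff 0 - S.coeff 1 * u‖ < 1 := by
    refine lt_of_le_of_lt key ?_
    nlinarith [norm_nonneg u]
  have : S.eval u = (S.eval u - S.coeff 0 - S.coeff 1 * u) + (S.coeff 0 + S.coeff 1 * u) := by
    ring
  change (ψ (S.eval u) : ℂ) = _
  rw [this, AddChar.map_add_eq_mul, hψ.1 _ hlt, one_mul]

omit [IsUltrametricDist K] [ProperSpace K] [MeasurableSpace K] [BorelSpace K] in
theorem norm_setIntegral_addChar_le {X : Type*} [MeasurableSpace X] {μ : Measure X} {A : Set X}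
    (hA : μ A ≠ ⊤) (ψ : AddChar K Circle) (g : X → K) :
    ‖∫ x in A, (ψ (g x) : ℂ) ∂μ‖ ≤ μ.real A := by
  refine (norm_setIntegral_le_of_norm_le_const (C := 1) hA.lt_top fun x _ => ?_).trans_eq
    (one_mul _)
  exact (Circle.norm_coe _).le

omit [IsUltrametricDist K] [ProperSpace K] [MeasurableSpace K] [BorelSpace K] in
theorem eval_add_mul_eq (Q : K[X]) (t e s : K) :
    Q.eval (t + e * s) = ((taylor t Q).comp (C e * X)).eval s := by
  simp [taylor_eval, add_comm]

/-- If `‖Q.coeff 1‖ ≥ 1` the integral is in fact zero: `u ↦ Q(t + u / Q₁)` has linear coefficient of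
norm `1` and higher ones of norm at most `1 / 2`, invisible to `ψ`. Otherwise the trivial bound
suffices. -/
theorem norm_integral_addChar_le_of_coeff_one {ψ : AddChar K Circle}
    (hψ : HasConductorMaximalIdeal ψ) {Q : K[X]} (hQ0 : Q.coeff 1 ≠ 0)
    (hQ : ∀ i, 1 < i → ‖Q.coeff i‖ ≤ 1 / 2 * ‖Q.coeff 1‖) :
    ‖∫ t in Metric.closedBall (0 : K) 1, (ψ (Q.eval t) : ℂ) ∂(haar K)‖ ≤ ‖Q.coeff 1‖⁻¹ := by
  have hL : 0 < ‖Q.coeff 1‖ := norm_pos_iff.mpr hQ0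
  have hfin : haar K (Metric.closedBall 0 1) ≠ ⊤ := by simp [haar_closedBall_one]
  rcases le_total ‖Q.coeff 1‖ 1 with hle | hle
  · refine (norm_setIntegral_addChar_le hfin ψ _).trans ?_
    rw [measureReal_def, haar_closedBall_one, ENNReal.toReal_one]
    exact (one_le_inv₀ hL).mpr hle
  refine (norm_setIntegral_le_of_translate (haar K) (haar K)
    Metric.isClosed_closedBall.measurableSet hfin Metric.isClosed_closedBall.measurableSet
    (haar_closedBall_one K) (φ := fun u => (Q.coeff 1)⁻¹ * u) (measurable_const_mul _) ?_
    (measurable_comp_addChar hψ Q.continuous) (fun x => (Circle.norm_coe _).le) (B := 0)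
    fun t ht => ?_).trans (by rw [zero_mul]; positivity)
  · intro u hu x
    have hu' : ‖(Q.coeff 1)⁻¹ * u‖ ≤ 1 := by
      rw [norm_mul, norm_inv]
      rw [mem_closedBall_zero_iff] at hu
      exact mul_le_one₀ (inv_le_one_of_one_le₀ hle) (norm_nonneg _) hu
    simp only [mem_closedBall_zero_iff]
    constructor
    · intro h
      have := IsUltrametricDist.norm_add_le_max (x + (Q.coeff 1)⁻¹ * u) (-((Q.coeff 1)⁻¹ * u))
      rw [add_neg_cancel_right, norm_neg] at this
      exact this.trans (max_le h hu')
    · intro h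
      exact (IsUltrametricDist.norm_add_le_max _ _).trans (max_le h hu')
  · rw [mem_closedBall_zero_iff] at ht
    simp only [eval_add_mul_eq]
    rw [integral_addChar_eval_eq_zero hψ (B := 1 / 2) _ (by norm_num), norm_zero]
    · intro i hi
      rw [comp_C_mul_X_coeff, norm_mul, norm_pow, norm_inv]
      have h1 : ‖(taylor t Q).coeff i‖ ≤ 1 / 2 * ‖Q.coeff 1‖ :=
        norm_coeff_taylor_le ht fun j hj => hQ j (by omega)
      have h2 : ‖Q.coeff 1‖⁻¹ ^ i ≤ ‖Q.coeff 1‖⁻¹ ^ 1 :=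
        pow_le_pow_of_le_one (by positivity) (inv_le_one_of_one_le₀ hle) hi.le
      refine (mul_le_mul h1 h2 (by positivity) (by positivity)).trans_eq ?_
      field_simp
    · rw [comp_C_mul_X_coeff, norm_mul, norm_pow, norm_inv,
        norm_coeff_taylor_eq ht hQ (by linarith), pow_one, mul_inv_cancel₀ hL.ne']

theorem norm_integral_addChar_le_aux (hK : IsNormalizedNorm K) {k : ℕ} (hk : 0 < k)
    (hk1 : ((k + 1 : ℕ) : K) ≠ 0) {θ C : ℝ} (hθ : 0 < θ) (hC : 0 ≤ C)
    (ih : ∀ ψ : AddChar K Circle, HasConductorMaximalIdeal ψ → ∀ Q : K[X], Q.coeff k ≠ 0 →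
      (∀ i, k < i → ‖Q.coeff i‖ ≤ θ * ‖Q.coeff k‖) →
      ‖∫ t in Metric.closedBall (0 : K) 1, (ψ (Q.eval t) : ℂ) ∂(haar K)‖ ≤
        C * ‖Q.coeff k‖ ^ (-(1 / (k : ℝ)))) :
    ∃ D : ℝ, 0 ≤ D ∧ ∀ ψ : AddChar K Circle, HasConductorMaximalIdeal ψ → ∀ Q : K[X],
      Q.coeff (k + 1) ≠ 0 →
      (∀ i, k + 1 < i → ‖Q.coeff i‖ ≤ ‖((k + 1 : ℕ) : K)‖ / 2 * ‖Q.coeff (k + 1)‖) →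
      ‖∫ t in Metric.closedBall (0 : K) 1, (ψ (Q.eval t) : ℂ) ∂(haar K)‖ ≤
        D * ‖Q.coeff (k + 1)‖ ^ (-(1 / ((k + 1 : ℕ) : ℝ))) := by
  obtain ⟨a, ha0, ha1, hvol⟩ := exists_haar_closedBall_eq K hK
  set κ : ℝ := ‖((k + 1 : ℕ) : K)‖ with hκ
  have hκ0 : 0 < κ := norm_pos_iff.mpr hk1
  have hκ1 : κ ≤ 1 := IsUltrametricDist.norm_natCast_le_one K _
  -- The extra factor `a ^ j` in the averaging scale makes the coefficients beyond the `k`-th small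
  -- enough for `ih`.
  obtain ⟨j, hj⟩ := exists_pow_lt_of_lt_one (mul_pos hθ hκ0) ha1
  have hA : 0 < κ * ‖a‖ * (‖a‖ * ‖a‖ ^ j) ^ k := by positivity
  obtain ⟨D, hD0, hD⟩ := le_mul_rpow_of_le_add_succ ha0 ha1 hk hA hC
  refine ⟨D, hD0, fun ψ hψ Q hQ0 hQ => ?_⟩
  set L : ℝ := ‖Q.coeff (k + 1)‖ with hL
  have hL0 : 0 < L := norm_pos_iff.mpr hQ0
  have hQ1 : ∀ i, k + 1 ≤ i → ‖Q.coeff i‖ ≤ L := by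
    intro i hi
    rcases hi.eq_or_lt with rfl | hi
    · exact le_rfl
    · exact (hQ i hi).trans (by nlinarith)
  have hcont : Continuous fun t : K => ‖(taylor t Q).coeff k‖ := by
    simp only [taylor_coeff]
    exact (Polynomial.continuous _).norm
  -- The Taylor coefficient need not vanish anywhere; at a minimum `t₀` the ultrametric inequality
  -- still bounds its difference from the value at `t` by the norm of the latter.
  obtain ⟨t₀, ht₀, hmin⟩ := (isCompact_closedBall (0 : K) 1).exists_isMinOn
    ⟨0, by simp⟩ hcont.continuousOn
  have ht₀' : ‖t₀‖ ≤ 1 := by simpa using ht₀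
  have hlow : ∀ t : K, ‖t‖ ≤ 1 → κ * L * ‖t - t₀‖ ≤ ‖(taylor t Q).coeff k‖ := by
    intro t ht
    rw [← norm_coeff_taylor_sub_coeff_taylor (θ := κ / 2) (by linarith) (by linarith) hQ0 hQ
      ht ht₀']
    have := IsUltrametricDist.norm_add_le_max ((taylor t Q).coeff k) (-(taylor t₀ Q).coeff k)
    rw [norm_neg, ← sub_eq_add_neg] at this
    exact this.trans (max_le le_rfl (hmin (by simpa using ht)))
  have hfin : ∀ m, haar K (Metric.closedBall t₀ (‖a‖ ^ m)) ≠ ⊤ := fun m =>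
    (isCompact_closedBall _ _).measure_lt_top.ne
  have hvol' : ∀ m, (haar K).real (Metric.closedBall t₀ (‖a‖ ^ m)) = ‖a‖ ^ m := by
    intro m
    rw [measureReal_def, Measure.addHaar_closedBall_center, hvol,
      ENNReal.toReal_ofReal (by positivity)]
  have hmeas : ∀ m, MeasurableSet (Metric.closedBall t₀ (‖a‖ ^ m)) := fun m =>
    Metric.isClosed_closedBall.measurableSet
  have hFm := measurable_comp_addChar hψ Q.continuous
  have hmain := hD L hL0
    (fun m => ‖∫ t in Metric.closedBall t₀ (‖a‖ ^ m), (ψ (Q.eval t) : ℂ) ∂(haar K)‖)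
    (fun m => (norm_setIntegral_addChar_le (hfin m) ψ _).trans_eq (hvol' m)) ?_
  · simp only [pow_zero] at hmain
    rwa [← IsUltrametricDist.closedBall_eq_of_mem ht₀] at hmain
  intro m
  have hsub : Metric.closedBall t₀ (‖a‖ ^ (m + 1)) ⊆ Metric.closedBall t₀ (‖a‖ ^ m) :=
    Metric.closedBall_subset_closedBall (pow_le_pow_of_le_one ha0.le ha1.le (Nat.le_succ m))
  have hint : IntegrableOn (fun t => (ψ (Q.eval t) : ℂ)) (Metric.closedBall t₀ (‖a‖ ^ m))
      (haar K) :=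
    Measure.integrableOn_of_bounded (M := 1) (hfin m) hFm.aestronglyMeasurable
      (Filter.Eventually.of_forall fun _ => (Circle.norm_coe _).le)
  have hsplit := integral_inter_add_sdiff (hmeas (m + 1)) hint
  rw [Set.inter_eq_self_of_subset_right hsub] at hsplit
  rw [← hsplit]
  refine (norm_add_le _ _).trans (add_le_add le_rfl ?_)
  set R := Metric.closedBall t₀ (‖a‖ ^ m) \ Metric.closedBall t₀ (‖a‖ ^ (m + 1)) with hR
  -- As `‖e‖` is at most the inner radius, translations by `e * s` with `‖s‖ ≤ 1` preserve both
  -- balls, hence the ring.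
  obtain ⟨e, he⟩ : ∃ e : K, e = a ^ (m + 1 + j) := ⟨_, rfl⟩
  have he0 : e ≠ 0 := he ▸ pow_ne_zero _ (norm_pos_iff.mp ha0)
  have hen : ‖e‖ = ‖a‖ ^ m * (‖a‖ * ‖a‖ ^ j) := by rw [he, norm_pow]; ring
  have he_le : ‖e‖ ≤ ‖a‖ ^ (m + 1) := by
    rw [he, norm_pow]
    exact pow_le_pow_of_le_one ha0.le ha1.le (by omega)
  have hRfin : haar K R ≠ ⊤ := ((measure_mono Set.sdiff_subset).trans_lt (hfin m).lt_top).ne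
  have hRvol : (haar K).real R ≤ ‖a‖ ^ m :=
    (measureReal_mono Set.sdiff_subset (hfin m)).trans_eq (hvol' m)
  have hball_add : ∀ n, n ≤ m + 1 → ∀ s ∈ Metric.closedBall (0 : K) 1, ∀ x,
      x + e * s ∈ Metric.closedBall t₀ (‖a‖ ^ n) ↔ x ∈ Metric.closedBall t₀ (‖a‖ ^ n) := by
    intro n hn s hs x
    rw [mem_closedBall_zero_iff] at hs
    have hes : ‖e * s‖ ≤ ‖a‖ ^ n := by
      rw [norm_mul]
      exact (mul_le_of_le_one_right (norm_nonneg _) hs).trans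
        (he_le.trans (pow_le_pow_of_le_one ha0.le ha1.le hn))
    simp only [mem_closedBall_iff_norm]
    constructor
    · intro h
      have := IsUltrametricDist.norm_add_le_max (x + e * s - t₀) (-(e * s))
      rw [norm_neg, show x + e * s - t₀ + -(e * s) = x - t₀ by ring] at this
      exact this.trans (max_le h hes)
    · intro h
      have := IsUltrametricDist.norm_add_le_max (x - t₀) (e * s)
      rw [show x - t₀ + e * s = x + e * s - t₀ by ring] at this
      exact this.trans (max_le h hes)
  refine (norm_setIntegral_le_of_translate (haar K) (haar K) (MeasurableSet.diff (hmeas m) (hmeas (m + 1)))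
    hRfin Metric.isClosed_closedBall.measurableSet (haar_closedBall_one K)
    (φ := fun u => e * u) (measurable_const_mul _) ?_ hFm (fun x => (Circle.norm_coe _).le)
    fun t ht => ?_).trans (mul_le_mul_of_nonneg_left hRvol (by positivity))
  · intro s hs x
    rw [Set.mem_sdiff, Set.mem_sdiff, hball_add m (by omega) s hs, hball_add (m + 1) le_rfl s hs]
  · have ht1 : ‖t‖ ≤ 1 := by
      have h1 : t ∈ Metric.closedBall t₀ 1 :=
        Metric.closedBall_subset_closedBall (pow_le_one₀ ha0.le ha1.le) ht.1
      rw [← IsUltrametricDist.closedBall_eq_of_mem ht₀] at h1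
      simpa using h1
    have htlow : ‖a‖ ^ (m + 1) ≤ ‖t - t₀‖ := by
      have := ht.2
      rw [mem_closedBall_iff_norm, not_le] at this
      exact this.le
    have hc : κ * L * ‖a‖ ^ (m + 1) ≤ ‖(taylor t Q).coeff k‖ :=
      (mul_le_mul_of_nonneg_left htlow (by positivity)).trans (hlow t ht1)
    have hc0 : 0 < κ * L * ‖a‖ ^ (m + 1) := by positivity
    simp only [eval_add_mul_eq]
    refine (ih ψ hψ _ ?_ ?_).trans (mul_le_mul_of_nonneg_left ?_ hC)
    · rw [comp_C_mul_X_coeff]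
      exact mul_ne_zero (norm_pos_iff.mp (hc0.trans_le hc)) (pow_ne_zero _ he0)
    · intro i hi
      rw [comp_C_mul_X_coeff, comp_C_mul_X_coeff, norm_mul, norm_mul, norm_pow, norm_pow]
      have h1 : ‖(taylor t Q).coeff i‖ ≤ L :=
        norm_coeff_taylor_le ht1 fun j hj => hQ1 j (by omega)
      have h2 : ‖e‖ ^ i ≤ ‖e‖ ^ (k + 1) :=
        pow_le_pow_of_le_one (norm_nonneg _) (he_le.trans (pow_le_one₀ ha0.le ha1.le)) hi
      calc ‖(taylor t Q).coeff i‖ * ‖e‖ ^ i ≤ L * ‖e‖ ^ (k + 1) :=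
            mul_le_mul h1 h2 (by positivity) hL0.le
        _ = L * ‖a‖ ^ (m + 1) * ‖e‖ ^ k * ‖a‖ ^ j := by rw [pow_succ ‖e‖ k, hen]; ring
        _ ≤ L * ‖a‖ ^ (m + 1) * ‖e‖ ^ k * (θ * κ) := by gcongr
        _ = θ * (κ * L * ‖a‖ ^ (m + 1) * ‖e‖ ^ k) := by ring
        _ ≤ θ * (‖(taylor t Q).coeff k‖ * ‖e‖ ^ k) := by gcongr
    · refine Real.rpow_le_rpow_of_nonpos (by positivity) ?_ ?_
      · rw [comp_C_mul_X_coeff, norm_mul, norm_pow, hen]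
        calc _ = κ * L * ‖a‖ ^ (m + 1) * (‖a‖ ^ m * (‖a‖ * ‖a‖ ^ j)) ^ k := by ring
          _ ≤ _ := by gcongr
      · have : 0 < 1 / (k : ℝ) := by positivity
        linarith

/-- The one-variable van der Corput estimate over a non-archimedean local field. -/
theorem exists_norm_integral_addChar_le (hK : IsNormalizedNorm K) {k : ℕ} (hk : 1 ≤ k)
    (hfac : ∀ i, 0 < i → i ≤ k → (i : K) ≠ 0) :
    ∃ θ : ℝ, 0 < θ ∧ ∃ C : ℝ, 0 ≤ C ∧ ∀ ψ : AddChar K Circle, HasConductorMaximalIdeal ψ →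
      ∀ Q : K[X], Q.coeff k ≠ 0 → (∀ i, k < i → ‖Q.coeff i‖ ≤ θ * ‖Q.coeff k‖) →
      ‖∫ t in Metric.closedBall (0 : K) 1, (ψ (Q.eval t) : ℂ) ∂(haar K)‖ ≤
        C * ‖Q.coeff k‖ ^ (-(1 / (k : ℝ))) := by
  induction k, hk using Nat.le_induction with
  | base =>
    refine ⟨1 / 2, by norm_num, 1, zero_le_one, fun ψ hψ Q hQ0 hQ => ?_⟩
    refine (norm_integral_addChar_le_of_coeff_one hψ hQ0 hQ).trans_eq ?_
    rw [Nat.cast_one, div_one, Real.rpow_neg_one, one_mul]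
  | succ k hk ih =>
    obtain ⟨θ, hθ, C, hC, h⟩ := ih fun i hi hik => hfac i hi (hik.trans (Nat.le_succ k))
    have hk1 : ((k + 1 : ℕ) : K) ≠ 0 := hfac (k + 1) (Nat.succ_pos k) le_rfl
    obtain ⟨D, hD, h'⟩ := norm_integral_addChar_le_aux hK hk hk1 hθ hC h
    exact ⟨‖((k + 1 : ℕ) : K)‖ / 2, half_pos (norm_pos_iff.mpr hk1), D, hD, h'⟩

end OneVariable

end OscInt
end

noncomputable section

namespace OscInt

open MvPolynomial

/-! ### Polynomials with coefficients in the valuation ring. -/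

section UnitBallSubring

variable (K : Type*) [NormedField K] [IsUltrametricDist K]

/-- The valuation ring, as a subring. -/
def unitBallSubring : Subring K where
  carrier := {x | ‖x‖ ≤ 1}
  mul_mem' {x y} hx hy := by
    rw [Set.mem_ofPred_eq, norm_mul]
    exact mul_le_one₀ hx (norm_nonneg y) hy
  one_mem' := by simp
  add_mem' {x y} hx hy := (IsUltrametricDist.norm_add_le_max x y).trans (max_le hx hy)
  zero_mem' := by simp
  neg_mem' {x} hx := by simpa using hx

variable {K} {n : ℕ}

theorem norm_coeff_le_one_of_mem_range {p : Polynomial K}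
    (hp : p ∈ (Polynomial.mapRingHom (unitBallSubring K).subtype).range) (i : ℕ) :
    ‖p.coeff i‖ ≤ 1 := by
  obtain ⟨q, rfl⟩ := hp
  rw [Polynomial.coe_mapRingHom, Polynomial.coeff_map]
  exact (q.coeff i).2

theorem norm_mvCoeff_le_one_of_mem_range {p : MvPolynomial (Fin n) K}
    (hp : p ∈ (MvPolynomial.map (σ := Fin n) (unitBallSubring K).subtype).range)
    (β : Fin n →₀ ℕ) : ‖p.coeff β‖ ≤ 1 := by
  obtain ⟨q, rfl⟩ := hp
  rw [MvPolynomial.coeff_map]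
  exact (q.coeff β).2

theorem norm_coeff_prod_le_one {z v : Fin n → K} (hz : z ∈ integerBox K n)
    (hv : v ∈ integerBox K n) (β : Fin n →₀ ℕ) (i : ℕ) :
    ‖(∏ j, (Polynomial.C (z j) + Polynomial.C (v j) * Polynomial.X) ^ β j).coeff i‖ ≤ 1 := by
  refine norm_coeff_le_one_of_mem_range (Subring.prod_mem _ fun j _ => Subring.pow_mem _ ?_ _) i
  exact ⟨Polynomial.C ⟨z j, hz j⟩ + Polynomial.C ⟨v j, hv j⟩ * Polynomial.X, by simp⟩

theorem norm_mvCoeff_prod_le_one {x : Fin n → K} (hx : x ∈ integerBox K n) (d β : Fin n →₀ ℕ) :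
    ‖(∏ j, (X j + C (x j) : MvPolynomial (Fin n) K) ^ d j).coeff β‖ ≤ 1 := by
  refine norm_mvCoeff_le_one_of_mem_range
    (Subring.prod_mem _ fun j _ => Subring.pow_mem _ ?_ _) β
  exact ⟨X j + C ⟨x j, hx j⟩, by simp⟩

end UnitBallSubring

/-! ### Restriction of a polynomial to a line. -/

section Lines

variable {K : Type*} [NormedField K] {n : ℕ}

theorem natDegree_linear_le (z v : K) :
    (Polynomial.C z + Polynomial.C v * Polynomial.X).natDegree ≤ 1 := by
  rw [add_comm]; exact Polynomial.natDegree_linear_le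

theorem natDegree_linear_pow_le (z v : K) (m : ℕ) :
    ((Polynomial.C z + Polynomial.C v * Polynomial.X) ^ m).natDegree ≤ m := by
  simpa using Polynomial.natDegree_pow_le_of_le m (natDegree_linear_le z v)

theorem natDegree_prod_linear_pow_le (z v : Fin n → K) (β : Fin n → ℕ) (s : Finset (Fin n)) :
    (∏ j ∈ s, (Polynomial.C (z j) + Polynomial.C (v j) * Polynomial.X) ^ β j).natDegree ≤
      ∑ j ∈ s, β j :=
  (Polynomial.natDegree_prod_le _ _).trans
    (Finset.sum_le_sum fun _ _ => natDegree_linear_pow_le _ _ _)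

theorem coeff_prod_linear_pow (z v : Fin n → K) (β : Fin n → ℕ) (s : Finset (Fin n)) :
    (∏ j ∈ s, (Polynomial.C (z j) + Polynomial.C (v j) * Polynomial.X) ^ β j).coeff
      (∑ j ∈ s, β j) = ∏ j ∈ s, v j ^ β j := by
  induction s using Finset.cons_induction with
  | empty => simp
  | cons j s hj ih =>
    rw [Finset.prod_cons, Finset.sum_cons, Finset.prod_cons,
      Polynomial.coeff_mul_add_eq_of_natDegree_le (natDegree_linear_pow_le _ _ _)
        (natDegree_prod_linear_pow_le z v β s), ih]
    have := Polynomial.coeff_pow_of_natDegree_le (m := β j) (natDegree_linear_le (z j) (v j))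
    rw [mul_one] at this
    rw [this]
    simp

/-- The restriction of `G` to the line `t ↦ a (z + t v)`. -/
def alongLine (G : MvPolynomial (Fin n) K) (a : K) (z v : Fin n → K) : Polynomial K :=
  aeval (fun j => Polynomial.C a * (Polynomial.C (z j) + Polynomial.C (v j) * Polynomial.X)) G

theorem eval_alongLine (G : MvPolynomial (Fin n) K) (a : K) (z v : Fin n → K) (t : K) :
    (alongLine G a z v).eval t = eval (a • (z + t • v)) G := by
  rw [alongLine, ← Polynomial.coe_aeval_eq_eval, ← AlgHom.coe_toRingHom, RingHom.coe_coe,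
    ← MvPolynomial.aeval_eq_eval]
  change ((Polynomial.aeval t).comp (aeval _)) G = _
  congr 1
  refine MvPolynomial.algHom_ext fun j => ?_
  simp only [AlgHom.comp_apply, aeval_X, map_mul, map_add, Polynomial.aeval_C,
    Polynomial.aeval_X, Algebra.algebraMap_self, RingHom.id_apply, Pi.smul_apply, Pi.add_apply,
    smul_eq_mul]
  ring

theorem coeff_alongLine (G : MvPolynomial (Fin n) K) (a : K) (z v : Fin n → K) (i : ℕ) :
    (alongLine G a z v).coeff i = ∑ d ∈ G.support, a ^ d.degree * (G.coeff d *
      (∏ j, (Polynomial.C (z j) + Polynomial.C (v j) * Polynomial.X) ^ d j).coeff i) := by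
  rw [alongLine, aeval_def, eval₂_eq', Polynomial.finsetSum_coeff]
  refine Finset.sum_congr rfl fun d _ => ?_
  simp only [mul_pow, Finset.prod_mul_distrib, Finset.prod_pow_eq_pow_sum]
  rw [← Finsupp.degree_eq_sum, ← Polynomial.C_pow, Polynomial.algebraMap_eq,
    Polynomial.coeff_C_mul, Polynomial.coeff_C_mul, mul_left_comm]

variable [IsUltrametricDist K]

theorem norm_coeff_alongLine_le {G : MvPolynomial (Fin n) K} {a : K} (ha : ‖a‖ ≤ 1)
    {z v : Fin n → K} (hz : z ∈ integerBox K n) (hv : v ∈ integerBox K n) {M : ℝ} (hM : 0 ≤ M)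
    {i : ℕ} (hG : ∀ β : Fin n →₀ ℕ, i ≤ β.degree → ‖G.coeff β‖ ≤ M) :
    ‖(alongLine G a z v).coeff i‖ ≤ ‖a‖ ^ i * M := by
  rw [coeff_alongLine]
  refine IsUltrametricDist.norm_sum_le_of_forall_le_of_nonneg (by positivity) fun d _ => ?_
  rcases lt_or_ge d.degree i with h | h
  · rw [Polynomial.coeff_eq_zero_of_natDegree_lt, mul_zero, mul_zero, norm_zero]
    · positivity
    · refine lt_of_le_of_lt (natDegree_prod_linear_pow_le z v d _) ?_
      rwa [← Finsupp.degree_eq_sum]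
  · rw [norm_mul, norm_mul, norm_pow]
    refine mul_le_mul (pow_le_pow_of_le_one (norm_nonneg _) ha h) ?_ (by positivity)
      (by positivity)
    exact (mul_le_of_le_one_right (norm_nonneg _) (norm_coeff_prod_le_one hz hv d i)).trans
      (hG d h)

/-- Monomials of degree below `k` do not reach `t ^ k`; those of degree `k` contribute only their
leading coefficient, in which `z` no longer appears; the others carry a factor `a ^ (k + 1)`. -/
theorem norm_coeff_alongLine_sub_le {G : MvPolynomial (Fin n) K} {a : K} (ha : ‖a‖ ≤ 1)
    {z v : Fin n → K} (hz : z ∈ integerBox K n) (hv : v ∈ integerBox K n) {M : ℝ} (hM : 0 ≤ M)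
    {k : ℕ} (hG : ∀ β : Fin n →₀ ℕ, k < β.degree → ‖G.coeff β‖ ≤ M) :
    ‖(alongLine G a z v).coeff k - a ^ k * eval v (homogeneousComponent k G)‖ ≤
      ‖a‖ ^ (k + 1) * M := by
  rw [coeff_alongLine, homogeneousComponent_apply, map_sum, Finset.sum_filter, Finset.mul_sum,
    ← Finset.sum_sub_distrib]
  refine IsUltrametricDist.norm_sum_le_of_forall_le_of_nonneg (by positivity) fun d _ => ?_
  rcases lt_trichotomy d.degree k with h | h | h
  · rw [Polynomial.coeff_eq_zero_of_natDegree_lt, mul_zero, mul_zero, if_neg h.ne, mul_zero,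
      sub_zero, norm_zero]
    · positivity
    · refine lt_of_le_of_lt (natDegree_prod_linear_pow_le z v d _) ?_
      rwa [← Finsupp.degree_eq_sum]
  · have h1 := coeff_prod_linear_pow z v d Finset.univ
    rw [← Finsupp.degree_eq_sum, h] at h1
    rw [h1, if_pos h, h, eval_monomial, Finsupp.prod_fintype _ _ (by simp), sub_self, norm_zero]
    positivity
  · rw [if_neg h.ne', mul_zero, sub_zero, norm_mul, norm_mul, norm_pow]
    refine mul_le_mul (pow_le_pow_of_le_one (norm_nonneg _) ha h) ?_ (by positivity)
      (by positivity)
    exact (mul_le_of_le_one_right (norm_nonneg _) (norm_coeff_prod_le_one hz hv d k)).trans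
      (hG d h)

end Lines

/-! ### Translates of a polynomial. -/

section Translate

variable {K : Type*} [NormedField K] {n : ℕ}

/-- The translate `G(X + x)` of a polynomial `G`. -/
def translate (x : Fin n → K) : MvPolynomial (Fin n) K →ₐ[K] MvPolynomial (Fin n) K :=
  aeval fun j => X j + C (x j)

theorem eval_translate (x z : Fin n → K) (G : MvPolynomial (Fin n) K) :
    eval z (translate x G) = eval (z + x) G := by
  rw [← MvPolynomial.aeval_eq_eval, ← MvPolynomial.aeval_eq_eval]
  change ((aeval z).comp (translate x)) G = _
  congr 1
  ext j
  simp [translate]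

theorem coeff_zero_translate (x : Fin n → K) (G : MvPolynomial (Fin n) K) :
    coeff 0 (translate x G) = eval x G := by
  have := eval_translate x 0 G
  rw [zero_add] at this
  rw [← this, ← constantCoeff_eq, MvPolynomial.eval_zero]

theorem pderiv_translate (x : Fin n → K) (j : Fin n) (G : MvPolynomial (Fin n) K) :
    pderiv j (translate x G) = translate x (pderiv j G) := by
  classical
  induction G using MvPolynomial.induction_on with
  | C a => simp [translate]
  | add p q hp hq => simp only [map_add, hp, hq]
  | mul_X p i hp =>
    have hX : translate x (X i) = X i + C (x i) := by simp [translate]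
    rw [map_mul, Derivation.leibniz, Derivation.leibniz, hp, hX, map_add, pderiv_C, add_zero]
    simp only [smul_eq_mul, map_add, map_mul, hX]
    rcases eq_or_ne i j with rfl | h
    · simp
    · rw [pderiv_X_of_ne h, map_zero]

theorem norm_coeff_translate_le [IsUltrametricDist K] {x : Fin n → K} (hx : x ∈ integerBox K n)
    {G : MvPolynomial (Fin n) K} {M : ℝ} (hM : 0 ≤ M) (hG : ∀ β, β ≠ 0 → ‖G.coeff β‖ ≤ M)
    {β : Fin n →₀ ℕ} (hβ : β ≠ 0) : ‖(translate x G).coeff β‖ ≤ M := by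
  classical
  rw [translate, aeval_def, eval₂_eq', coeff_sum]
  refine IsUltrametricDist.norm_sum_le_of_forall_le_of_nonneg hM fun d _ => ?_
  rw [algebraMap_eq, coeff_C_mul, norm_mul]
  rcases eq_or_ne d 0 with rfl | hd
  · simpa [coeff_one, hβ.symm] using hM
  · exact (mul_le_of_le_one_right (norm_nonneg _) (norm_mvCoeff_prod_le_one hx d β)).trans
      (hG d hd)

end Translate

/-! ### A good direction for a form. -/

section Directions

variable (K : Type*) [NontriviallyNormedField K] [CompleteSpace K] (n k : ℕ)

/-- A form of degree `k` takes, at some point of the polydisc, a value comparable with its largest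
coefficient. -/
theorem exists_norm_coeff_le_norm_eval : ∃ c : ℝ, 0 < c ∧ ∀ G : MvPolynomial (Fin n) K,
    ∃ v ∈ integerBox K n, ∀ β : Fin n →₀ ℕ, β.degree = k →
      c * ‖G.coeff β‖ ≤ ‖eval v (homogeneousComponent k G)‖ := by
  classical
  obtain ⟨p, hp0, hp1⟩ := NormedField.exists_norm_lt_one K
  have hinj : Function.Injective fun m : ℕ => p ^ m := by
    intro m m' h
    have h' : ‖p‖ ^ m = ‖p‖ ^ m' := by simpa using congrArg norm h
    exact (pow_right_strictAnti₀ hp0 hp1).injective h'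
  let D := (Finset.univ : Finset (Fin n)).finsuppAntidiag k
  -- A form of degree `k` vanishing on a grid with `k + 1` points per coordinate is zero. Evaluation
  -- on the grid of powers of `p` is thus an injective linear map `T` of finite-dimensional spaces,
  -- hence bounded below.
  have hD : ∀ β : Fin n →₀ ℕ, β ∈ D ↔ β.degree = k := by
    intro β
    simp [D, Finset.mem_finsuppAntidiag, Finsupp.degree_eq_sum]
  let form : (D → K) → MvPolynomial (Fin n) K := fun b => ∑ β : D, monomial β.1 (b β)
  let pt : (Fin n → Fin (k + 1)) → Fin n → K := fun g j => p ^ (g j : ℕ)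
  let T : (D → K) →ₗ[K] ((Fin n → Fin (k + 1)) → K) :=
    { toFun := fun b g => eval (pt g) (form b)
      map_add' := fun b b' => by
        funext g
        simp [form, Finset.sum_add_distrib]
      map_smul' := fun r b => by
        funext g
        simp [form, Finset.mul_sum, eval_monomial, mul_assoc] }
  have hcoeff : ∀ (b : D → K) (β : D), coeff β.1 (form b) = b β := by
    intro b β
    simp only [form, coeff_sum, coeff_monomial]
    rw [Finset.sum_eq_single β]
    · simp
    · intro β' _ h
      rw [if_neg fun h' => h (Subtype.ext h')]
    · simp
  have hker : T.ker = ⊥ := by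
    rw [LinearMap.ker_eq_bot']
    intro b hb
    have h0 : form b = 0 := by
      refine eq_zero_of_eval_zero_at_prod_finset (form b)
        (fun _ => (Finset.range (k + 1)).image fun m => p ^ m) (fun i => ?_) fun x hx => ?_
      · rw [Finset.card_image_of_injective _ hinj, Finset.card_range, Nat.lt_succ_iff]
        refine (degreeOf_le_totalDegree _ _).trans (totalDegree_finsetSum_le fun β _ => ?_)
        refine (totalDegree_monomial_le _ _).trans_eq ?_
        exact (hD β.1).mp β.2
      · simp only [Finset.mem_image, Finset.mem_range] at hx
        choose g hg hgx using hx
        have : x = pt fun j => ⟨g j, hg j⟩ := funext fun j => (hgx j).symm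
        rw [this]
        exact congrFun hb _
    funext β
    rw [← hcoeff b β, h0, coeff_zero, Pi.zero_apply]
  obtain ⟨κ, hκ, hT⟩ := T.exists_antilipschitzWith hker
  have hκ' : (0 : ℝ) < κ := hκ
  refine ⟨(κ : ℝ)⁻¹, inv_pos.mpr hκ', fun G => ?_⟩
  have hform : form (fun β => G.coeff β.1) = homogeneousComponent k G := by
    ext β
    rw [coeff_homogeneousComponent]
    split_ifs with h
    · exact hcoeff (fun β => G.coeff β.1) ⟨β, (hD β).mpr h⟩
    · simp only [form, coeff_sum, coeff_monomial]
      refine Finset.sum_eq_zero fun β' _ => if_neg ?_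
      rintro rfl
      exact h ((hD _).mp β'.2)
  have hbound := hT.le_mul_norm (map_zero T) fun β => G.coeff β.1
  obtain ⟨g, hg⟩ := Finite.exists_max fun g => ‖T (fun β => G.coeff β.1) g‖
  have hnorm : ‖T (fun β => G.coeff β.1)‖ ≤ ‖T (fun β => G.coeff β.1) g‖ :=
    (pi_norm_le_iff_of_nonneg (norm_nonneg _)).mpr hg
  refine ⟨pt g, fun j => ?_, fun β hβ => ?_⟩
  · rw [norm_pow]
    exact pow_le_one₀ hp0.le hp1.le
  · have h1 : ‖G.coeff β‖ ≤ ‖fun β : D => G.coeff β.1‖ :=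
      norm_le_pi_norm (fun β : D => G.coeff β.1) ⟨β, (hD β).mpr hβ⟩
    have h2 : T (fun β => G.coeff β.1) g = eval (pt g) (homogeneousComponent k G) := by
      rw [← hform]; rfl
    rw [← h2, inv_mul_le_iff₀ hκ']
    exact h1.trans (hbound.trans (mul_le_mul_of_nonneg_left hnorm hκ'.le))

end Directions

end OscInt
end

noncomputable section

namespace OscInt

open MeasureTheory

/-! ### Iterated derivatives and Taylor coefficients. -/

section Derivatives

variable {K : Type*} [NormedField K] {n : ℕ}

/-- Successive partial derivatives of a power series, along a list of variables. -/
def pderivList (l : List (Fin n)) : Module.End K (MvPowerSeries (Fin n) K) :=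
  (l.map fun j => ((MvPowerSeries.pderiv K j).toLinearMap :
    Module.End K (MvPowerSeries (Fin n) K))).prod

/-- Successive partial derivatives of a polynomial, along a list of variables. -/
def polyPderivList (l : List (Fin n)) : Module.End K (MvPolynomial (Fin n) K) :=
  (l.map fun j => ((MvPolynomial.pderiv j).toLinearMap :
    Module.End K (MvPolynomial (Fin n) K))).prod

theorem pderivList_cons (j : Fin n) (l : List (Fin n)) (f : MvPowerSeries (Fin n) K) :
    pderivList (j :: l) f = MvPowerSeries.pderiv K j (pderivList l f) := by
  simp [pderivList]

theorem polyPderivList_cons (j : Fin n) (l : List (Fin n)) (P : MvPolynomial (Fin n) K) :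
    polyPderivList (j :: l) P = MvPolynomial.pderiv j (polyPderivList l P) := by
  simp [polyPderivList]

theorem exists_list_iteratedPDeriv (α : Fin n → ℕ) : ∃ l : List (Fin n),
    (∀ f : MvPowerSeries (Fin n) K, iteratedPDeriv α f = pderivList l f) ∧
      (l.map fun j => Finsupp.single j 1).sum = Finsupp.equivFunOnFinite.symm α := by
  refine ⟨((List.finRange n).map fun j => List.replicate (α j) j).flatten, fun f => ?_, ?_⟩
  · rw [iteratedPDeriv, pderivList, List.map_flatten, List.prod_flatten, List.map_map,
      List.map_map, List.ofFn_eq_map]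
    congr 2
    refine List.map_congr_left fun j _ => ?_
    simp
  · rw [List.map_flatten, List.sum_flatten, List.map_map, List.map_map]
    have : ((List.sum ∘ List.map fun j => Finsupp.single j 1) ∘
        fun j => List.replicate (α j) j) = fun j : Fin n => Finsupp.single j (α j) := by
      funext j
      simp
    rw [this, ← Fin.sum_univ_def]
    exact Finsupp.univ_sum_single (Finsupp.equivFunOnFinite.symm α)

theorem pderivList_coe (l : List (Fin n)) (P : MvPolynomial (Fin n) K) :
    pderivList l (P : MvPowerSeries (Fin n) K) = (polyPderivList l P : MvPolynomial (Fin n) K) := by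
  induction l with
  | nil => simp [pderivList, polyPderivList]
  | cons j l ih => rw [pderivList_cons, polyPderivList_cons, ih, MvPowerSeries.pderiv_coe]

theorem polyPderivList_translate (l : List (Fin n)) (x : Fin n → K)
    (P : MvPolynomial (Fin n) K) :
    polyPderivList l (translate x P) = translate x (polyPderivList l P) := by
  induction l with
  | nil => simp [polyPderivList]
  | cons j l ih => rw [polyPderivList_cons, polyPderivList_cons, ih, pderiv_translate]

/-- The value of `N` is immaterial: what is used later is that it is a natural number, so `‖N‖ ≤ 1`,
and independent of `f`. -/
theorem exists_coeff_pderivList (l : List (Fin n)) (β : Fin n →₀ ℕ) : ∃ N : ℕ,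
    ∀ f : MvPowerSeries (Fin n) K, MvPowerSeries.coeff β (pderivList l f) =
      (N : K) * MvPowerSeries.coeff (β + (l.map fun j => Finsupp.single j 1).sum) f := by
  induction l generalizing β with
  | nil => exact ⟨1, fun f => by simp [pderivList]⟩
  | cons j l ih =>
    obtain ⟨N, hN⟩ := ih (β + Finsupp.single j 1)
    refine ⟨N * (β j + 1), fun f => ?_⟩
    rw [pderivList_cons, MvPowerSeries.coeff_pderiv, hN, List.map_cons, List.sum_cons, add_assoc]
    push_cast
    ring

theorem exists_coeff_iteratedPDeriv (α : Fin n → ℕ) (β : Fin n →₀ ℕ) : ∃ N : ℕ,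
    ∀ f : MvPowerSeries (Fin n) K, MvPowerSeries.coeff β (iteratedPDeriv α f) =
      (N : K) * MvPowerSeries.coeff (β + Finsupp.equivFunOnFinite.symm α) f := by
  obtain ⟨l, hl, hα⟩ := exists_list_iteratedPDeriv (K := K) α
  obtain ⟨N, hN⟩ := exists_coeff_pderivList (K := K) l β
  exact ⟨N, fun f => by rw [hl, hN, hα]⟩

theorem exists_eval_iteratedPDeriv (α : Fin n → ℕ) (P : MvPolynomial (Fin n) K) :
    ∃ R : MvPolynomial (Fin n) K, iteratedPDeriv α (P : MvPowerSeries (Fin n) K) = R ∧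
      ∀ x, ∃ N : ℕ, MvPolynomial.eval x R =
        (N : K) * (translate x P).coeff (Finsupp.equivFunOnFinite.symm α) := by
  obtain ⟨l, hl, hα⟩ := exists_list_iteratedPDeriv (K := K) α
  refine ⟨polyPderivList l P, by rw [hl, pderivList_coe], fun x => ?_⟩
  obtain ⟨N, hN⟩ := exists_coeff_pderivList (K := K) l 0
  refine ⟨N, ?_⟩
  rw [← coeff_zero_translate, ← polyPderivList_translate, ← MvPolynomial.coeff_coe,
    ← pderivList_coe, hN, hα, zero_add, MvPolynomial.coeff_coe]

end Derivatives

/-! ### Values of power series and polynomial approximation. -/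

section Evaluation

variable {K : Type*} [NormedField K] {n : ℕ}

theorem convergesOnIntegers_iff (f : MvPowerSeries (Fin n) K) : ConvergesOnIntegers f ↔
    Filter.Tendsto (fun β => ‖MvPowerSeries.coeff β f‖) Filter.cofinite (nhds 0) := by
  simp [ConvergesOnIntegers, MvPowerSeries.IsRestricted, Finsupp.prod]

theorem convergesOnIntegers_coe (P : MvPolynomial (Fin n) K) :
    ConvergesOnIntegers (P : MvPowerSeries (Fin n) K) := by
  rw [convergesOnIntegers_iff]
  refine tendsto_nhds_of_eventually_eq ?_
  refine (P.support.finite_toSet).subset fun β hβ => ?_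
  simpa using hβ

theorem norm_coeff_le_gaussNorm {f : MvPowerSeries (Fin n) K} (hf : ConvergesOnIntegers f)
    (β : Fin n →₀ ℕ) : ‖MvPowerSeries.coeff β f‖ ≤ gaussNorm f := by
  have := MvPowerSeries.le_gaussNorm (fun a : K => ‖a‖) (fun _ => 1) f
    (Filter.Tendsto.bddAbove_range_of_cofinite hf) β
  simpa [Finsupp.prod, gaussNorm] using this

theorem evalAt_coe (P : MvPolynomial (Fin n) K) (x : Fin n → K) :
    evalAt (P : MvPowerSeries (Fin n) K) x = MvPolynomial.eval x P := by
  rw [evalAt, MvPolynomial.eval_eq', tsum_eq_sum (s := P.support)]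
  · simp
  · intro β hβ
    rw [MvPolynomial.coeff_coe, MvPolynomial.notMem_support_iff.mp hβ, zero_mul]

theorem norm_coeff_mul_prod_le {x : Fin n → K} (hx : x ∈ integerBox K n) (a : K)
    (β : Fin n →₀ ℕ) : ‖a * ∏ j, x j ^ β j‖ ≤ ‖a‖ := by
  rw [norm_mul, norm_prod]
  refine mul_le_of_le_one_right (norm_nonneg _)
    (Finset.prod_le_one (fun _ _ => norm_nonneg _) fun j _ => ?_)
  rw [norm_pow]
  exact pow_le_one₀ (norm_nonneg _) (hx j)

variable [IsUltrametricDist K]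

theorem ConvergesOnIntegers.iteratedPDeriv {f : MvPowerSeries (Fin n) K}
    (hf : ConvergesOnIntegers f) (α : Fin n → ℕ) :
    ConvergesOnIntegers (iteratedPDeriv α f) := by
  rw [convergesOnIntegers_iff] at hf ⊢
  refine squeeze_zero (fun _ => norm_nonneg _) (fun β => ?_)
    (hf.comp (add_left_injective (Finsupp.equivFunOnFinite.symm α)).tendsto_cofinite)
  obtain ⟨N, hN⟩ := exists_coeff_iteratedPDeriv (K := K) α β
  rw [hN]
  exact norm_natCast_mul_le _ _

theorem norm_evalAt_sub_le [CompleteSpace K] {f g : MvPowerSeries (Fin n) K}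
    (hf : ConvergesOnIntegers f) (hg : ConvergesOnIntegers g) {ε : ℝ} (hε : 0 ≤ ε)
    (h : ∀ β, ‖MvPowerSeries.coeff β (f - g)‖ ≤ ε) {x : Fin n → K} (hx : x ∈ integerBox K n) :
    ‖evalAt f x - evalAt g x‖ ≤ ε := by
  have hs : ∀ g : MvPowerSeries (Fin n) K, ConvergesOnIntegers g →
      Summable fun β : Fin n →₀ ℕ => MvPowerSeries.coeff β g * ∏ j, x j ^ β j := by
    intro g hg
    refine NonarchimedeanAddGroup.summable_of_tendsto_cofinite_zero ?_
    rw [convergesOnIntegers_iff] at hg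
    exact squeeze_zero_norm (fun β => norm_coeff_mul_prod_le hx _ β) hg
  rw [evalAt, evalAt, ← (hs f hf).tsum_sub (hs g hg)]
  refine IsUltrametricDist.norm_tsum_le_of_forall_le_of_nonneg hε fun β => ?_
  rw [← sub_mul, ← map_sub]
  exact (norm_coeff_mul_prod_le hx _ β).trans (h β)

theorem norm_coeff_iteratedPDeriv_sub_le {f g : MvPowerSeries (Fin n) K} {ε : ℝ}
    (h : ∀ β, ‖MvPowerSeries.coeff β (f - g)‖ ≤ ε) (α : Fin n → ℕ) (β : Fin n →₀ ℕ) :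
    ‖MvPowerSeries.coeff β (OscInt.iteratedPDeriv α f - OscInt.iteratedPDeriv α g)‖ ≤ ε := by
  obtain ⟨N, hN⟩ := exists_coeff_iteratedPDeriv (K := K) α β
  rw [map_sub, hN, hN, ← mul_sub, ← map_sub]
  exact (norm_natCast_mul_le _ _).trans (h _)

omit [IsUltrametricDist K] in
-- Only finitely many coefficients have norm at least `ε`, and the polynomial keeps exactly these.
-- Bounds on the coefficients of `f` therefore pass to it.
theorem exists_polynomial_approx {f : MvPowerSeries (Fin n) K} (hf : ConvergesOnIntegers f)
    {ε : ℝ} (hε : 0 < ε) : ∃ P : MvPolynomial (Fin n) K,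
      (∀ β, ‖P.coeff β‖ ≤ ‖MvPowerSeries.coeff β f‖) ∧
        ∀ β, ‖MvPowerSeries.coeff β (f - (P : MvPowerSeries (Fin n) K))‖ ≤ ε := by
  classical
  rw [convergesOnIntegers_iff] at hf
  have hfin : {β | ¬ ‖MvPowerSeries.coeff β f‖ < ε}.Finite := hf.eventually (gt_mem_nhds hε)
  have hP : ∀ β, MvPolynomial.coeff β (∑ d ∈ hfin.toFinset,
      MvPolynomial.monomial d (MvPowerSeries.coeff d f)) =
      if ‖MvPowerSeries.coeff β f‖ < ε then 0 else MvPowerSeries.coeff β f := by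
    intro β
    simp only [MvPolynomial.coeff_sum, MvPolynomial.coeff_monomial, Finset.sum_ite_eq',
      Set.Finite.mem_toFinset, Set.mem_ofPred_eq, ite_not]
  refine ⟨∑ d ∈ hfin.toFinset, MvPolynomial.monomial d (MvPowerSeries.coeff d f),
    fun β => ?_, fun β => ?_⟩
  · rw [hP]
    split_ifs
    · simp
    · exact le_rfl
  · rw [map_sub, MvPolynomial.coeff_coe, hP]
    split_ifs with h
    · simpa using h.le
    · simpa using hε.le

end Evaluation

end OscInt
end

noncomputable section

namespace OscInt

open MeasureTheory

/-! ### Reduction to one variable and conclusion. -/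

section Assembly

variable {K : Type*} [NontriviallyNormedField K] [IsUltrametricDist K] [ProperSpace K]
  [MeasurableSpace K] [BorelSpace K]

omit [ProperSpace K] [MeasurableSpace K] [BorelSpace K] in
theorem add_mem_integerBox_iff {n : ℕ} {w : Fin n → K} (hw : w ∈ integerBox K n)
    (z : Fin n → K) : z + w ∈ integerBox K n ↔ z ∈ integerBox K n := by
  refine forall_congr' fun j => ⟨fun h => ?_, fun h => ?_⟩
  · have := IsUltrametricDist.norm_add_le_max ((z + w) j) (-(w j))
    rw [Pi.add_apply, add_neg_cancel_right, norm_neg] at this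
    exact this.trans (max_le h (hw j))
  · exact (IsUltrametricDist.norm_add_le_max _ _).trans (max_le h (hw j))

omit [IsUltrametricDist K] [ProperSpace K] [MeasurableSpace K] [BorelSpace K] in
theorem smul_mem_integerBox {n : ℕ} {w : Fin n → K} (hw : w ∈ integerBox K n) {a : K}
    (ha : ‖a‖ ≤ 1) : a • w ∈ integerBox K n := fun j => by
  rw [Pi.smul_apply, smul_eq_mul, norm_mul]
  exact mul_le_one₀ ha (norm_nonneg _) (hw j)

/-- The estimate for polynomials in several variables whose nonconstant coefficients are bounded
by `M`. -/
theorem exists_norm_integral_polynomial_le (hK : IsNormalizedNorm K) {k : ℕ} (hk : 0 < k)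
    (hfac : ∀ i, 0 < i → i ≤ k → (i : K) ≠ 0) (n : ℕ) {M : ℝ} (hM : 0 ≤ M) :
    ∃ D : ℝ, ∀ ψ : AddChar K Circle, HasConductorMaximalIdeal ψ →
      ∀ P : MvPolynomial (Fin n) K, (∀ β, β ≠ 0 → ‖P.coeff β‖ ≤ M) →
      ∀ γ : Fin n →₀ ℕ, γ.degree = k →
      (∀ x ∈ integerBox K n, 1 ≤ ‖(translate x P).coeff γ‖) → ∀ y : K, y ≠ 0 →
        ‖∫ x in integerBox K n, (ψ (y * MvPolynomial.eval x P) : ℂ) ∂(haarPi K n)‖ ≤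
          D * ‖y‖ ^ (-(1 / (k : ℝ))) := by
  obtain ⟨θ, hθ, C, hC, hone⟩ := exists_norm_integral_addChar_le hK hk hfac
  obtain ⟨c, hc, hdir⟩ := exists_norm_coeff_le_norm_eval K n k
  -- The factor `θ` meets the hypothesis of the one-variable estimate; `1 / 2` keeps the degree `k`
  -- form dominant in the coefficient of `t ^ k`.
  have hr : 0 < min 1 (min θ (1 / 2) * c / (M + 1)) := by positivity
  obtain ⟨a, ha0, har⟩ := NormedField.exists_norm_lt K hr
  have ha1 : ‖a‖ ≤ 1 := (har.trans_le (min_le_left _ _)).le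
  have haM : ‖a‖ * M ≤ min θ (1 / 2) * c := by
    have h1 := (har.trans_le (min_le_right _ _)).le
    rw [le_div_iff₀ (by linarith)] at h1
    nlinarith
  have haM1 : ‖a‖ * M ≤ θ * c :=
    haM.trans (mul_le_mul_of_nonneg_right (min_le_left _ _) hc.le)
  have haM2 : ‖a‖ * M < c := by
    have := mul_le_mul_of_nonneg_right (min_le_right θ (1 / 2)) hc.le
    linarith
  refine ⟨C * (c * ‖a‖ ^ k) ^ (-(1 / (k : ℝ))), fun ψ hψ P hP γ hγ hder y hy => ?_⟩
  have hy0 : 0 < ‖y‖ := norm_pos_iff.mpr hy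
  have hbox := measurableSet_integerBox K n
  have hvol := haarPi_integerBox K n
  have hvol' : (haarPi K n).real (integerBox K n) = 1 := by
    rw [measureReal_def, hvol, ENNReal.toReal_one]
  have hboxfin : haarPi K n (integerBox K n) ≠ ⊤ := by rw [hvol]; exact ENNReal.one_ne_top
  have hcont : ∀ g : (Fin n → K) → Fin n → K, Continuous g →
      Continuous fun z => y * MvPolynomial.eval (g z) P := fun g hg =>
    continuous_const.mul ((MvPolynomial.continuous_eval P).comp hg)
  have hmeas : ∀ g : (Fin n → K) → Fin n → K, Continuous g →
      Measurable fun z => (ψ (y * MvPolynomial.eval (g z) P) : ℂ) := fun g hg =>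
    measurable_comp_addChar hψ (hcont g hg)
  refine (norm_setIntegral_le_of_translate (haarPi K n) (haarPi K n) hbox hboxfin hbox hvol
    (φ := fun z => a • z) (measurable_const_smul a)
    (fun z hz x => add_mem_integerBox_iff (smul_mem_integerBox hz ha1) x) (hmeas _ continuous_id)
    (fun _ => (Circle.norm_coe _).le) fun x hx => ?_).trans_eq (by rw [hvol', mul_one])
  -- The direction depends on `x`, so `x` itself cannot be translated along it. After the first
  -- averaging `x` is fixed and the variable is `z`, which can.
  obtain ⟨v, hv, hvdir⟩ := hdir (translate x P)
  have hHc : c ≤ ‖MvPolynomial.eval v (MvPolynomial.homogeneousComponent k (translate x P))‖ := by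
    have := hvdir γ hγ
    have h1 := hder x hx
    nlinarith
  refine (norm_setIntegral_le_of_translate (haarPi K n) (haar K) hbox hboxfin
    (T := Metric.closedBall 0 1) Metric.isClosed_closedBall.measurableSet
    (haar_closedBall_one K) (φ := fun t => t • v) (by fun_prop)
    (fun t ht z => add_mem_integerBox_iff
      (smul_mem_integerBox hv (mem_closedBall_zero_iff.mp ht)) z)
    (hmeas (fun z => x + a • z) (by fun_prop))
    (fun _ => (Circle.norm_coe _).le) fun z hz => ?_).trans_eq (by rw [hvol', mul_one])
  have hline : ∀ t : K, y * MvPolynomial.eval (x + a • (z + t • v)) P =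
      (Polynomial.C y * alongLine (translate x P) a z v).eval t := by
    intro t
    rw [Polynomial.eval_mul, Polynomial.eval_C, eval_alongLine, eval_translate, add_comm x]
  simp only [hline]
  have hG : ∀ β : Fin n →₀ ℕ, k < β.degree → ‖(translate x P).coeff β‖ ≤ M := by
    intro β hβ
    refine norm_coeff_translate_le hx hM hP ?_
    rintro rfl
    simp at hβ
  have hak : 0 < ‖a‖ ^ k := by positivity
  have hsub := norm_coeff_alongLine_sub_le ha1 hz hv hM hG
  have hmain : ‖a ^ k * MvPolynomial.eval v
      (MvPolynomial.homogeneousComponent k (translate x P))‖ ≥ c * ‖a‖ ^ k := by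
    rw [norm_mul, norm_pow, mul_comm c]
    gcongr
  have herr : ‖a‖ ^ (k + 1) * M < c * ‖a‖ ^ k := by
    rw [pow_succ, mul_assoc, mul_comm c]
    gcongr
  have hSk : c * ‖a‖ ^ k ≤ ‖(alongLine (translate x P) a z v).coeff k‖ := by
    rw [norm_eq_of_norm_sub_lt (lt_of_le_of_lt hsub (herr.trans_le hmain))]
    exact hmain
  have hSk0 : 0 < ‖(alongLine (translate x P) a z v).coeff k‖ :=
    lt_of_lt_of_le (by positivity) hSk
  refine (hone ψ hψ _ ?_ fun i hi => ?_).trans ?_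
  · rw [Polynomial.coeff_C_mul]
    exact mul_ne_zero hy (norm_pos_iff.mp hSk0)
  · rw [Polynomial.coeff_C_mul, Polynomial.coeff_C_mul, norm_mul, norm_mul, mul_left_comm]
    refine mul_le_mul_of_nonneg_left ?_ hy0.le
    have h1 : ‖(alongLine (translate x P) a z v).coeff i‖ ≤ ‖a‖ ^ i * M :=
      norm_coeff_alongLine_le ha1 hz hv hM fun β hβ => hG β (lt_of_lt_of_le hi hβ)
    calc _ ≤ ‖a‖ ^ i * M := h1
      _ ≤ ‖a‖ ^ (k + 1) * M :=
        mul_le_mul_of_nonneg_right (pow_le_pow_of_le_one ha0.le ha1 hi) hM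
      _ = ‖a‖ ^ k * (‖a‖ * M) := by ring
      _ ≤ ‖a‖ ^ k * (θ * c) := by gcongr
      _ = θ * (c * ‖a‖ ^ k) := by ring
      _ ≤ _ := by gcongr
  · rw [mul_assoc, ← Real.mul_rpow (by positivity) hy0.le]
    refine mul_le_mul_of_nonneg_left (Real.rpow_le_rpow_of_nonpos (by positivity) ?_ ?_) hC
    · rw [Polynomial.coeff_C_mul, norm_mul, mul_comm]
      gcongr
    · have : 0 < 1 / (k : ℝ) := by positivity
      linarith

omit [IsUltrametricDist K] [ProperSpace K] [MeasurableSpace K] [BorelSpace K] in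
theorem natCast_ne_zero_of_ringChar {k : ℕ} (hchar : ringChar K = 0 ∨ k < ringChar K) (i : ℕ)
    (hi : 0 < i) (hik : i ≤ k) : (i : K) ≠ 0 := by
  intro h
  have hdvd := (ringChar.spec K i).mp h
  have hle := Nat.le_of_dvd hi hdvd
  rcases hchar with h0 | h0
  · rw [h0, zero_dvd_iff] at hdvd
    omega
  · omega

omit [IsUltrametricDist K] [ProperSpace K] [MeasurableSpace K] [BorelSpace K] in
theorem norm_coeff_le_gaussNorm_sub_C {n : ℕ} {f : MvPowerSeries (Fin n) K}
    (hf : ConvergesOnIntegers f) {β : Fin n →₀ ℕ} (hβ : β ≠ 0) :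
    ‖MvPowerSeries.coeff β f‖ ≤
      gaussNorm (f - MvPowerSeries.C (MvPowerSeries.constantCoeff f)) := by
  classical
  have hg : ConvergesOnIntegers (f - MvPowerSeries.C (MvPowerSeries.constantCoeff f)) := by
    rw [ConvergesOnIntegers, sub_eq_add_neg]
    exact MvPowerSeries.isRestricted.add _ hf
      (MvPowerSeries.isRestricted.neg _ (MvPowerSeries.isRestricted_C _ _))
  have := norm_coeff_le_gaussNorm hg β
  rwa [map_sub, MvPowerSeries.coeff_C, if_neg hβ, sub_zero] at this

end Assembly

end OscInt
end

open MeasureTheory OscInt in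
theorem proposition3p4
    (K : Type*) [NontriviallyNormedField K] [IsUltrametricDist K] [ProperSpace K]
    [MeasurableSpace K] [BorelSpace K] (hK : IsNormalizedNorm K)
    (n k : ℕ) (hk : 0 < k) (hchar : ringChar K = 0 ∨ k < ringChar K) :
    ∃ d : ℝ → ℝ, ∀ (ψ : AddChar K Circle), HasConductorMaximalIdeal ψ →
      ∀ (f : MvPowerSeries (Fin n) K), ConvergesOnIntegers f →
      ∀ (α : Fin n → ℕ), ∑ j, α j = k →
      (∀ x ∈ integerBox K n, 1 ≤ ‖evalAt (iteratedPDeriv α f) x‖) →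
      ∀ y : K, y ≠ 0 →
        ‖∫ x in integerBox K n, (ψ (y * evalAt f x) : ℂ) ∂(haarPi K n)‖ ≤
          d (gaussNorm (f - MvPowerSeries.C (MvPowerSeries.constantCoeff f))) *
            ‖y‖ ^ (-(1 / (k : ℝ))) := by
  have hfac := natCast_ne_zero_of_ringChar hchar
  -- The maximum with `0` makes the constant available for every real argument.
  choose D hD using fun M : ℝ =>
    exists_norm_integral_polynomial_le hK hk hfac n (le_max_left 0 M)
  refine ⟨D, fun ψ hψ f hf α hα hder y hy => ?_⟩
  have hy0 : 0 < ‖y‖ := norm_pos_iff.mpr hy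
  -- The bound `1 / (2 * ‖y‖)` puts `y * (f - P)` in the maximal ideal, where `ψ` is trivial; `1 /
  -- 2` leaves the norm of the derivative, which is at least `1`, unchanged.
  obtain ⟨P, hPle, hPsub⟩ := exists_polynomial_approx hf
    (ε := min (1 / 2) (1 / (2 * ‖y‖))) (by positivity)
  have hε0 : 0 ≤ min (1 / 2) (1 / (2 * ‖y‖)) := by positivity
  have hPc := convergesOnIntegers_coe P
  have hval : ∀ x ∈ integerBox K n, ψ (y * evalAt f x) = ψ (y * MvPolynomial.eval x P) := by
    intro x hx
    have h1 := norm_evalAt_sub_le hf hPc hε0 hPsub hx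
    rw [evalAt_coe] at h1
    have h2 : ‖y * (evalAt f x - MvPolynomial.eval x P)‖ < 1 := by
      rw [norm_mul]
      calc ‖y‖ * ‖evalAt f x - MvPolynomial.eval x P‖ ≤ ‖y‖ * (1 / (2 * ‖y‖)) := by
            gcongr
            exact h1.trans (min_le_right _ _)
        _ = 1 / 2 := by field_simp
        _ < 1 := by norm_num
    have h3 : y * evalAt f x =
        y * (evalAt f x - MvPolynomial.eval x P) + y * MvPolynomial.eval x P := by ring
    rw [h3, AddChar.map_add_eq_mul, hψ.1 _ h2, one_mul]
  have hcoeff : ∀ x ∈ integerBox K n,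
      1 ≤ ‖(translate x P).coeff (Finsupp.equivFunOnFinite.symm α)‖ := by
    intro x hx
    have h1 := norm_evalAt_sub_le (hf.iteratedPDeriv α) (hPc.iteratedPDeriv α) hε0
      (norm_coeff_iteratedPDeriv_sub_le hPsub α) hx
    obtain ⟨R, hR, hRx⟩ := exists_eval_iteratedPDeriv α P
    obtain ⟨N, hN⟩ := hRx x
    rw [hR, evalAt_coe, norm_sub_rev] at h1
    have h2 := hder x hx
    have h3 : ‖MvPolynomial.eval x R‖ = ‖evalAt (iteratedPDeriv α f) x‖ :=
      norm_eq_of_norm_sub_lt (lt_of_le_of_lt (h1.trans (min_le_left _ _)) (by linarith))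
    rw [← h3, hN] at h2
    exact h2.trans (norm_natCast_mul_le _ _)
  rw [setIntegral_congr_fun (measurableSet_integerBox K n)
    fun x hx => congrArg ((↑) : Circle → ℂ) (hval x hx)]
  exact hD _ ψ hψ P
    (fun β hβ => (hPle β).trans ((norm_coeff_le_gaussNorm_sub_C hf hβ).trans (le_max_right _ _)))
    _ (by rw [Finsupp.degree_eq_sum, ← hα]; rfl) hcoeff y hy
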